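/- Let $N_B,T\ge 1$ be integers, $P_b>0$, $\sigma_u^2>0$, $0<\phi\le 1$, $0<\epsilon<1$. Let $\mathbf h_u,\mathbf e\sim\mathcal{CN}(0,\mathbf I_{N_B})$, the noise $n\sim\mathcal{CN}(0,\sigma_u^2)$ and the information signal $u$ be independent, let $\mathbf v=\overline{\mathbf h_u}/\|\mathbf h_u\|$ with $\mathbb E\|\mathbf v u\|^2=1$, and let the user receive $$y=\sqrt{P_b}\,\mathbf h_d\mathbf v u+n=\sqrt{P_b\phi}\,\|\mathbf h_u\|u+\tilde n,\qquad \mathbf h_d=\sqrt\phi\,\mathbf h_u^T+\sqrt{1-\phi}\,\mathbf e^T,\qquad \tilde n=\sqrt{P_b(1-\phi)}\,\mathbf e^T\mathbf v u+n .$$ Put $\gamma_u=P_b\phi\|\mathbf h_u\|^2/\mathrm{Var}(\tilde n)$, $C(\gamma)=\log_2(1+\gamma)$, $V(\gamma)=(\log_2 e)^2\bigl(1-(1+\gamma)^{-2}\bigr)$, let $Q^{-1}$ be the inverse of $Q(x)=\frac1{\sqrt{2\pi}}\int_x^\infty e^{-t^2/2}dt$, and let $$R_u=\mathbb E\Bigl[C(\gamma_u)-\sqrt{V(\gamma_u)/T}\;Q^{-1}(\epsilon)\Bigr]$$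 be the finite-blocklength lower bound on the downlink rate under uplink channel training. Put $\rho_b=P_b/\sigma_u^2$ and $\gamma=\gamma^u_{\rm eff}=\rho_b\phi/((1-\phi)\rho_b+1)$. Then $\gamma_u=\gamma\|\mathbf h_u\|^2$, all expectations below are finite, and, with $X\sim\mathrm{Gamma}(N_B,1)$: (1) $R_u=\Phi(\gamma,N_B)-D$, where exactly $$\Phi(\gamma,N_B)=\mathbb E[C(\gamma\|\mathbf h_u\|^2)]=\mathbb E[\log_2(1+\gamma X)]=\frac{e^{1/\gamma}}{\ln 2\;\Gamma(N_B)\,\gamma^{N_B}}\sum_{i=0}^{N_B-1}\binom{N_B-1}{i}(-1)^{N_B-1-i}\,G^{3,0}_{2,3}\!\left(\begin{matrix}-i,-i\\0,-1-i,-1-i\end{matrix}\,\middle|\,\frac1\gamma\right)$$ ($G$ is the Meijer G-function), and $D=\mathbb E\bigl[\sqrt{V(\gamma\|\mathbf h_u\|^2)/T}\bigr]Q^{-1}(\epsilon)=\mathbb E\bigl[\sqrt{V(\gamma X)/T}\bigr]Q^{-1}(\epsilon)$. (2) The leading-order Laplace approximation of $D$ for large $N_B$ is $$\Psi(\gamma,N_B,T)=\sqrt{\frac{2\pi}{T}}\,\frac{Q^{-1}(\epsilon)}{\Gamma(N_B)\ln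 2}\,e^{-(N_B-1)}(N_B-1)^{N_B-\frac12}\sqrt{1-\bigl(1+\gamma(N_B-1)\bigr)^{-2}},$$ so that $R_u\approx\Phi(\gamma,N_B)-\Psi(\gamma,N_B,T)$, in the following sense: there is an absolute constant $K$ (independent of all parameters) such that for all $N_B\ge 2$ $$|D-\Psi(\gamma,N_B,T)|\le\frac{K}{N_B-1}\,|\Psi(\gamma,N_B,T)|\quad\text{and}\quad |R_u-(\Phi(\gamma,N_B)-\Psi(\gamma,N_B,T))|\le\frac{K}{N_B-1}\,|\Psi(\gamma,N_B,T)| .$$ -/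

import Mathlib

open MeasureTheory ProbabilityTheory Real
open scoped NNReal

noncomputable section

namespace UplinkTraining

/-! ### The Meijer G-function -/

/-- The Mellin-Barnes integrand of `G^{m,n}_{p,q}(z | a; b)`. Mathlib's `Complex.Gamma` is `0` at
the poles of `Γ`, so a reciprocal of it is the entire function `1/Γ` everywhere. -/
def meijerGIntegrand (m n : ℕ) {p q : ℕ} (a : Fin p → ℂ) (b : Fin q → ℂ) (z s : ℂ) : ℂ :=
  ((∏ j : Fin q with j.val < m, Complex.Gamma (b j - s)) *
      (∏ j : Fin p with j.val < n, Complex.Gamma (1 - a j + s))) /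
    ((∏ j : Fin q with m ≤ j.val, Complex.Gamma (1 - b j + s)) *
      (∏ j : Fin p with n ≤ j.val, Complex.Gamma (a j - s))) * z ^ s

/-- The line `Re s = c` has the poles of `Γ(b_j - s)`, `j ≤ m`, on its right and the poles of
`Γ(1 - a_j + s)`, `j ≤ n`, on its left. -/
def IsSeparating (m n : ℕ) {p q : ℕ} (a : Fin p → ℂ) (b : Fin q → ℂ) (c : ℝ) : Prop :=
  (∀ j : Fin q, j.val < m → c < (b j).re) ∧ (∀ j : Fin p, j.val < n → (a j).re - 1 < c)

/-- `(1 / (2 π i)) ∫ f(s) ds` along the line `Re s = c`, from `c - i∞` to `c + i∞`, where `f` is the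
Mellin-Barnes integrand. -/
def meijerGLine (m n : ℕ) {p q : ℕ} (a : Fin p → ℂ) (b : Fin q → ℂ) (z : ℂ) (c : ℝ) : ℂ :=
  (1 / (2 * (π : ℂ))) * ∫ t : ℝ, meijerGIntegrand m n a b z ((c : ℂ) + (t : ℂ) * Complex.I)

open Classical in
/-- The Meijer G-function `G^{m,n}_{p,q}(z | a; b)` as a Mellin-Barnes integral along a vertical line
that separates the two families of poles. This is the standard definition if such a line exists (for
`n = 0` it always does), `p + q < 2 (m + n)` and `|arg z| < (m + n - (p + q) / 2) π`; by Cauchy's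
theorem the choice of the line does not matter. Parameters without a separating line are not used
and get the value `0`. -/
def meijerG (m n : ℕ) {p q : ℕ} (a : Fin p → ℂ) (b : Fin q → ℂ) (z : ℂ) : ℂ :=
  if h : ∃ c : ℝ, IsSeparating m n a b c then meijerGLine m n a b z h.choose else 0

/-! ### Finite-blocklength quantities -/

/-- The Gaussian tail function `Q(x) = P(Z > x)`, `Z` standard normal. -/
def Qfun (x : ℝ) : ℝ := (gaussianReal 0 1).real (Set.Ioi x)

/-- The inverse of `Q`, a strictly decreasing bijection from `ℝ` onto `(0,1)`. -/
def Qinv (ε : ℝ) : ℝ := Function.invFun Qfun ε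

/-- The channel capacity `C(γ) = log₂ (1 + γ)`. -/
def capacity (γ : ℝ) : ℝ := Real.logb 2 (1 + γ)

/-- The channel dispersion `V(γ) = (log₂ e)² (1 - (1 + γ)⁻²)`. -/
def dispersion (γ : ℝ) : ℝ := (Real.logb 2 (Real.exp 1)) ^ 2 * (1 - ((1 + γ) ^ 2)⁻¹)

/-- The rate loss `√(V(γ) / T) Q⁻¹(ε)` at blocklength `T` and error probability `ε`. -/
def rateLoss (T : ℕ) (ε γ : ℝ) : ℝ := √(1 / (T : ℝ) * dispersion γ) * Qinv ε

/-! ### The system model -/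

/-- The law `CN(0, v)` on `ℂ`: independent real and imaginary parts, both `N(0, v/2)`. -/
def complexGaussian (v : ℝ≥0) : Measure ℂ :=
  ((gaussianReal 0 (v / 2)).prod (gaussianReal 0 (v / 2))).map
    (fun p : ℝ × ℝ => (p.1 : ℂ) + (p.2 : ℂ) * Complex.I)

/-- The law `CN(0, I_N)` on `ℂ^N`: i.i.d. entries with law `CN(0, 1)`. -/
def complexGaussianVec (N : ℕ) : Measure (EuclideanSpace ℂ (Fin N)) :=
  (Measure.pi (fun _ : Fin N => complexGaussian 1)).map (WithLp.toLp 2)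

/-- The product `gᵀ w` of a row and a column vector (no complex conjugation). -/
def rowMul {N : ℕ} (g w : EuclideanSpace ℂ (Fin N)) : ℂ := ∑ j, g j * w j

/-- The normalized beamforming vector matched to the channel `h`, for which `hᵀ v = ‖h‖`. -/
def beamformer {N : ℕ} (h : EuclideanSpace ℂ (Fin N)) : EuclideanSpace ℂ (Fin N) :=
  ((‖h‖⁻¹ : ℝ) : ℂ) • WithLp.toLp 2 (fun j => (starRingEnd ℂ) (h j))

/-- The downlink channel `√φ h_u + √(1-φ) e`. -/
def downlink {N : ℕ} (φ : ℝ) (hu e : EuclideanSpace ℂ (Fin N)) : EuclideanSpace ℂ (Fin N) :=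
  ((√φ : ℝ) : ℂ) • hu + ((√(1 - φ) : ℝ) : ℂ) • e

/-- The received signal `√P h_dᵀ x + n`, where `x = v u`. -/
def received {N : ℕ} (P φ : ℝ) (hu e : EuclideanSpace ℂ (Fin N)) (u n : ℂ) : ℂ :=
  ((√P : ℝ) : ℂ) * rowMul (downlink φ hu e) (u • beamformer hu) + n

/-- The interference plus noise `√(P (1-φ)) eᵀ v u + n`. -/
def effNoise {N : ℕ} (P φ : ℝ) (hu e : EuclideanSpace ℂ (Fin N)) (u n : ℂ) : ℂ :=
  ((√(P * (1 - φ)) : ℝ) : ℂ) * rowMul e (beamformer hu) * u + n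

theorem rowMul_beamformer {N : ℕ} (h : EuclideanSpace ℂ (Fin N)) :
    rowMul h (beamformer h) = ((‖h‖ : ℝ) : ℂ) := by
  have h1 : rowMul h (beamformer h) = ((‖h‖⁻¹ : ℝ) : ℂ) * ((‖h‖ ^ 2 : ℝ) : ℂ) := by
    rw [EuclideanSpace.norm_sq_eq]
    push_cast
    rw [Finset.mul_sum]
    refine Finset.sum_congr rfl fun j _ => ?_
    rw [← Complex.mul_conj']
    simp [beamformer]
    ring
  rw [h1, ← Complex.ofReal_mul]
  congr 1
  rcases eq_or_ne ‖h‖ 0 with h0 | h0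
  · simp [h0]
  · field_simp

/-- The received signal is the useful part `√(P φ) ‖h_u‖ u` plus the interference and noise. -/
theorem received_eq {N : ℕ} {P φ : ℝ} (hP : 0 ≤ P) (hu e : EuclideanSpace ℂ (Fin N)) (u n : ℂ) :
    received P φ hu e u n =
      ((√(P * φ) : ℝ) : ℂ) * ((‖hu‖ : ℝ) : ℂ) * u + effNoise P φ hu e u n := by
  have h1 : rowMul (downlink φ hu e) (u • beamformer hu) =
      ((√φ : ℝ) : ℂ) * rowMul hu (beamformer hu) * u +
        ((√(1 - φ) : ℝ) : ℂ) * rowMul e (beamformer hu) * u := by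
    simp only [rowMul, downlink, Finset.mul_sum, Finset.sum_mul, ← Finset.sum_add_distrib]
    refine Finset.sum_congr rfl fun j _ => ?_
    simp
    ring
  rw [received, effNoise, h1, rowMul_beamformer, Real.sqrt_mul hP, Real.sqrt_mul hP]
  push_cast
  ring

/-- The variance `E|X - E X|²` of a complex random variable. -/
def complexVar {Ω : Type*} [MeasurableSpace Ω] (μ : Measure Ω) (X : Ω → ℂ) : ℝ :=
  ∫ ω, ‖X ω - ∫ ω', X ω' ∂μ‖ ^ 2 ∂μ

/-- The system: uplink channel `hu` and uncertain part `e` with law `CN(0, I_N)`, noise `n` with law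
`CN(0, σ2)`, information signal `u` for which the transmitted signal `u v` has unit average power;
`hu`, `e`, `u`, `n` are (mutually) independent. -/
structure IsUplinkModel {Ω : Type*} [MeasurableSpace Ω] {N : ℕ} (μ : Measure Ω) (σ2 : ℝ≥0)
    (hu e : Ω → EuclideanSpace ℂ (Fin N)) (u n : Ω → ℂ) : Prop where
  hu_law : HasLaw hu (complexGaussianVec N) μ
  e_law : HasLaw e (complexGaussianVec N) μ
  n_law : HasLaw n (complexGaussian σ2) μ
  u_meas : AEMeasurable u μ
  power : ∫ ω, ‖u ω • beamformer (hu ω)‖ ^ 2 ∂μ = 1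
  indep_hu_e : IndepFun hu e μ
  indep_u : IndepFun (fun ω => (hu ω, e ω)) u μ
  indep_n : IndepFun (fun ω => (hu ω, e ω, u ω)) n μ

/-- The variance of the interference plus noise. -/
def effNoiseVar {Ω : Type*} [MeasurableSpace Ω] {N : ℕ} (μ : Measure Ω) (P φ : ℝ)
    (hu e : Ω → EuclideanSpace ℂ (Fin N)) (u n : Ω → ℂ) : ℝ :=
  complexVar μ (fun ω => effNoise P φ (hu ω) (e ω) (u ω) (n ω))

/-- The SINR `γ_u = P φ ‖h_u‖² / Var(interference plus noise)` at the user. -/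
def sinr {Ω : Type*} [MeasurableSpace Ω] {N : ℕ} (μ : Measure Ω) (P φ : ℝ)
    (hu e : Ω → EuclideanSpace ℂ (Fin N)) (u n : Ω → ℂ) (ω : Ω) : ℝ :=
  P * φ * ‖hu ω‖ ^ 2 / effNoiseVar μ P φ hu e u n

/-- The lower bound `R_u = E[C(γ_u) - √(V(γ_u) / T) Q⁻¹(ε)]` on the downlink data rate. -/
def rateUplink {Ω : Type*} [MeasurableSpace Ω] {N : ℕ} (μ : Measure Ω) (P φ : ℝ)
    (hu e : Ω → EuclideanSpace ℂ (Fin N)) (u n : Ω → ℂ) (T : ℕ) (ε : ℝ) : ℝ :=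
  ∫ ω, (capacity (sinr μ P φ hu e u n ω) - rateLoss T ε (sinr μ P φ hu e u n ω)) ∂μ

/-- The effective SNR `ρ φ / ((1 - φ) ρ + 1)`. -/
def effSNR (ρ φ : ℝ) : ℝ := ρ * φ / ((1 - φ) * ρ + 1)

/-! ### The closed forms -/

/-- The closed form `Φ(γ, N)` of the capacity term. -/
def Phi (γ : ℝ) (N : ℕ) : ℂ :=
  ((Real.exp (1 / γ) / (Real.log 2 * Real.Gamma N * γ ^ N) : ℝ) : ℂ) *
    ∑ i ∈ Finset.range N, ((N - 1).choose i : ℂ) * (-1) ^ (N - 1 - i) *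
      meijerG 3 0 ![-(i : ℂ), -(i : ℂ)] ![0, -1 - (i : ℂ), -1 - (i : ℂ)] ((1 / γ : ℝ) : ℂ)

/-- The Laplace-method closed form `Ψ(γ, N, T)` of the dispersion term. -/
def Psi (γ : ℝ) (N T : ℕ) (ε : ℝ) : ℝ :=
  √(2 * π / T) * (Qinv ε / (Real.Gamma N * Real.log 2)) * Real.exp (-((N : ℝ) - 1)) *
    ((N : ℝ) - 1) ^ ((N : ℝ) - 1 / 2) * √(1 - ((1 + γ * ((N : ℝ) - 1)) ^ 2)⁻¹)

end UplinkTraining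

end

/-!
The channel gain `‖h_u‖²` is a sum of squares of independent Gaussians, so it has law `Gamma(N, 1)`.
Interference, signal and noise are independent and the beamformer has unit norm, so
`Var(ñ) = P (1 - φ) + σ²` and the SINR is `γ ‖h_u‖²`.

For `Φ`, the substitution `t = 1 + γ x` turns `E[log (1 + γ X)]` into the Laplace transform at
`1 / γ` of `(t - 1)^(N-1) log⁺ t`. The Mellin transform of the Laplace transform of `t^i log⁺ t` is
`Γ(w) / (w - 1 - i)²`, which is the Mellin-Barnes integrand of the G-function with index `i`; Mellin
inversion and the binomial theorem conclude.

For `Ψ`, let `c = N - 1` be the mode of the Gamma density and `f(x) = √(1 - (1 + γ x)⁻²)`. Up to a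
common factor, `D` is `E[f(X)]`, and `Ψ` is `f(c)` times Stirling's approximation of `c!` divided by
`c!`. The function `f` lies between two quadratics in `x / c - 1` with leading term `f(c)` and with
coefficients that are `f(c)` times absolute constants, so the first two moments of `X` give
`E[f(X)] = f(c) (1 + O(1 / c))` uniformly in `γ`, and Stirling's formula is as precise.
-/

namespace UplinkTraining

open Set Filter
open Complex (I)
open scoped Topology

/-! ### Gamma laws -/

section GammaMeasure

variable {E : Type*} [NormedAddCommGroup E] [NormedSpace ℝ E] {a b r : ℝ}

theorem gammaPDFReal_of_pos {x : ℝ} (hx : 0 < x) :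
    gammaPDFReal a r x = r ^ a / Gamma a * x ^ (a - 1) * exp (-(r * x)) :=
  if_pos hx.le

theorem gammaMeasure_eq_withDensity_Ioi (a r : ℝ) :
    gammaMeasure a r = (volume.restrict (Ioi 0)).withDensity (gammaPDF a r) := by
  rw [gammaMeasure, ← withDensity_indicator measurableSet_Ioi]
  refine withDensity_congr_ae ?_
  filter_upwards [Measure.ae_ne volume (0 : ℝ)] with x hx
  rcases hx.lt_or_gt with h | h
  · rw [gammaPDF_of_neg h, indicator_of_notMem (notMem_Ioi.2 h.le)]
  · rw [indicator_of_mem (mem_Ioi.2 h)]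

theorem ae_gammaMeasure_pos (a r : ℝ) : ∀ᵐ x ∂gammaMeasure a r, 0 < x := by
  rw [gammaMeasure_eq_withDensity_Ioi]
  exact (withDensity_absolutelyContinuous _ _).ae_le (ae_restrict_mem measurableSet_Ioi)

theorem measurable_gammaPDF (a r : ℝ) : Measurable (gammaPDF a r) :=
  (measurable_gammaPDFReal a r).ennreal_ofReal

theorem integral_gammaMeasure (ha : 0 < a) (hr : 0 < r) (f : ℝ → E) :
    ∫ x, f x ∂gammaMeasure a r = ∫ x in Ioi 0, gammaPDFReal a r x • f x := by
  rw [gammaMeasure_eq_withDensity_Ioi, integral_withDensity_eq_integral_toReal_smul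
    (measurable_gammaPDF a r) (.of_forall fun _ => ENNReal.ofReal_lt_top)]
  simp only [gammaPDF, ENNReal.toReal_ofReal (gammaPDFReal_nonneg ha hr _)]

theorem integrable_gammaMeasure_iff (ha : 0 < a) (hr : 0 < r) {f : ℝ → E} :
    Integrable f (gammaMeasure a r) ↔ IntegrableOn (fun x => gammaPDFReal a r x • f x) (Ioi 0) := by
  rw [gammaMeasure_eq_withDensity_Ioi, integrable_withDensity_iff_integrable_smul'
    (measurable_gammaPDF a r) (.of_forall fun _ => ENNReal.ofReal_lt_top)]
  simp only [gammaPDF, ENNReal.toReal_ofReal (gammaPDFReal_nonneg ha hr _), IntegrableOn]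

theorem integrableOn_gammaPDFReal (ha : 0 < a) (hr : 0 < r) :
    IntegrableOn (gammaPDFReal a r) (Ioi 0) := by
  have := isProbabilityMeasure_gammaMeasure ha hr
  simpa using (integrable_gammaMeasure_iff ha hr).1 (integrable_const (1 : ℝ))

theorem setIntegral_gammaPDFReal (ha : 0 < a) (hr : 0 < r) :
    ∫ x in Ioi 0, gammaPDFReal a r x = 1 := by
  have := isProbabilityMeasure_gammaMeasure ha hr
  simpa using (integral_gammaMeasure ha hr fun _ => (1 : ℝ)).symm

-- Multiplying a Gamma density by a power or by an exponential changes its shape or its rate.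
section ChangeOfParameters

variable {s : ℝ} {f : ℝ → ℝ} {C : ℝ}

theorem integrable_gammaMeasure_of_mul_eq (ha : 0 < a) (hr : 0 < r) (hb : 0 < b) (hs : 0 < s)
    (h : ∀ x, 0 < x → gammaPDFReal a r x * f x = C * gammaPDFReal b s x) :
    Integrable f (gammaMeasure a r) :=
  (integrable_gammaMeasure_iff ha hr).2 <|
    IntegrableOn.congr_fun ((integrableOn_gammaPDFReal hb hs).const_mul C)
      (fun x hx => (h x hx).symm) measurableSet_Ioi

theorem integral_gammaMeasure_of_mul_eq (ha : 0 < a) (hr : 0 < r) (hb : 0 < b) (hs : 0 < s)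
    (h : ∀ x, 0 < x → gammaPDFReal a r x * f x = C * gammaPDFReal b s x) :
    ∫ x, f x ∂gammaMeasure a r = C := by
  rw [integral_gammaMeasure ha hr]
  simp only [smul_eq_mul]
  rw [setIntegral_congr_fun measurableSet_Ioi h, integral_const_mul, setIntegral_gammaPDFReal hb hs,
    mul_one]

end ChangeOfParameters

theorem gammaPDFReal_mul_pow (ha : 0 < a) (hr : 0 < r) (k : ℕ) {x : ℝ} (hx : 0 < x) :
    gammaPDFReal a r x * x ^ k =
      Gamma (a + k) / (Gamma a * r ^ k) * gammaPDFReal (a + k) r x := by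
  rw [gammaPDFReal_of_pos hx, gammaPDFReal_of_pos hx, rpow_add hr, rpow_natCast, add_sub_right_comm,
    rpow_add hx, rpow_natCast]
  field_simp

theorem integrable_pow_gammaMeasure (ha : 0 < a) (hr : 0 < r) (k : ℕ) :
    Integrable (fun x => x ^ k) (gammaMeasure a r) :=
  integrable_gammaMeasure_of_mul_eq ha hr (by positivity : 0 < a + k) hr
    fun _ hx => gammaPDFReal_mul_pow ha hr k hx

theorem integral_pow_gammaMeasure (ha : 0 < a) (hr : 0 < r) (k : ℕ) :
    ∫ x, x ^ k ∂gammaMeasure a r = Gamma (a + k) / (Gamma a * r ^ k) :=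
  integral_gammaMeasure_of_mul_eq ha hr (by positivity : 0 < a + k) hr
    fun _ hx => gammaPDFReal_mul_pow ha hr k hx

theorem gammaPDFReal_mul_exp {t : ℝ} (hr : 0 < r) (ht : t < r) {x : ℝ} (hx : 0 < x) :
    gammaPDFReal a r x * exp (t * x) = (r / (r - t)) ^ a * gammaPDFReal a (r - t) x := by
  have h : 0 < r - t := sub_pos.2 ht
  rw [gammaPDFReal_of_pos hx, gammaPDFReal_of_pos hx, mul_assoc _ (exp _), ← exp_add,
    div_rpow hr.le h.le, show -(r * x) + t * x = -((r - t) * x) by ring]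
  have := (rpow_pos_of_pos h a).ne'
  field_simp

theorem integrable_exp_mul_gammaMeasure (ha : 0 < a) (hr : 0 < r) {t : ℝ} (ht : t < r) :
    Integrable (fun x => exp (t * x)) (gammaMeasure a r) :=
  integrable_gammaMeasure_of_mul_eq ha hr ha (sub_pos.2 ht)
    fun _ hx => gammaPDFReal_mul_exp hr ht hx

theorem mgf_id_gammaMeasure (ha : 0 < a) (hr : 0 < r) {t : ℝ} (ht : t < r) :
    mgf id (gammaMeasure a r) t = (r / (r - t)) ^ a :=
  integral_gammaMeasure_of_mul_eq ha hr ha (sub_pos.2 ht)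
    fun _ hx => gammaPDFReal_mul_exp hr ht hx

theorem complexMGF_id_gammaMeasure (ha : 0 < a) (hr : 0 < r) {z : ℂ} (hz : z.re < r) :
    complexMGF id (gammaMeasure a r) z = (1 - z / r) ^ (-a : ℂ) := by
  set U : Set ℂ := {z | z.re < r}
  have hU : IsOpen U := isOpen_lt Complex.continuous_re continuous_const
  have hset : Iio r ⊆ interior (integrableExpSet id (gammaMeasure a r)) :=
    interior_maximal (fun t ht => integrable_exp_mul_gammaMeasure ha hr ht) isOpen_Iio
  have hmgf : AnalyticOnNhd ℂ (complexMGF id (gammaMeasure a r)) U :=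
    analyticOnNhd_complexMGF.mono fun w hw => hset hw
  have hpow : AnalyticOnNhd ℂ (fun w : ℂ => (1 - w / r) ^ (-a : ℂ)) U := by
    refine DifferentiableOn.analyticOnNhd (fun w hw => ?_) hU
    have hre : 0 < (1 - w / r).re := by
      have : w.re < r := hw
      simpa [Complex.div_ofReal_re, sub_pos, div_lt_one hr] using this
    have hdiff : DifferentiableAt ℂ (fun w : ℂ => 1 - w / r) w := by fun_prop
    exact (hdiff.cpow_const (.inl hre)).differentiableWithinAt
  -- Both sides are analytic in the half plane and agree on the negative real axis.
  refine hmgf.eqOn_of_preconnected_of_frequently_eq hpow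
    (convex_halfSpace_re_lt r).isPreconnected (z₀ := 0) (by simpa [U] using hr) ?_ hz
  have hlim : Tendsto (fun t : ℝ => (t : ℂ)) (𝓝[<] 0) (𝓝[≠] 0) := by
    refine tendsto_nhdsWithin_iff.2 ⟨?_, ?_⟩
    · simpa using (Complex.continuous_ofReal.tendsto 0).mono_left nhdsWithin_le_nhds
    · filter_upwards [self_mem_nhdsWithin] with t ht
      simpa using (mem_Iio.1 ht).ne
  refine hlim.frequently (Eventually.frequently ?_)
  filter_upwards [self_mem_nhdsWithin] with t ht
  have ht : t < r := (mem_Iio.1 ht).trans hr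
  have h : 0 ≤ 1 - t / r := by
    rw [sub_nonneg, div_le_one hr]
    exact ht.le
  rw [complexMGF_ofReal, mgf_id_gammaMeasure ha hr ht,
    show r / (r - t) = (1 - t / r)⁻¹ by rw [one_sub_div hr.ne', inv_div], inv_rpow h,
    ← rpow_neg h, Complex.ofReal_cpow h]
  push_cast
  rfl

theorem charFun_gammaMeasure (ha : 0 < a) (hr : 0 < r) (t : ℝ) :
    charFun (gammaMeasure a r) t = (1 - t * I / r) ^ (-a : ℂ) := by
  rw [← complexMGF_id_mul_I, complexMGF_id_gammaMeasure ha hr (by simpa using hr)]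

theorem gammaMeasure_conv_gammaMeasure (ha : 0 < a) (hb : 0 < b) (hr : 0 < r) :
    gammaMeasure a r ∗ gammaMeasure b r = gammaMeasure (a + b) r := by
  have := isProbabilityMeasure_gammaMeasure ha hr
  have := isProbabilityMeasure_gammaMeasure hb hr
  have := isProbabilityMeasure_gammaMeasure (add_pos ha hb) hr
  refine Measure.ext_of_charFun (funext fun t => ?_)
  have h : (1 - t * I / r : ℂ) ≠ 0 := fun h => by simpa using congrArg Complex.re h
  rw [charFun_conv, charFun_gammaMeasure ha hr, charFun_gammaMeasure hb hr,
    charFun_gammaMeasure (add_pos ha hb) hr, ← Complex.cpow_add _ _ h]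
  push_cast
  ring_nf

theorem hasLaw_sum_gammaMeasure {Ω ι : Type*} [MeasurableSpace Ω] {μ : Measure Ω}
    {X : ι → Ω → ℝ} (ha : 0 < a) (hr : 0 < r) (hX : ∀ i, HasLaw (X i) (gammaMeasure a r) μ)
    (hind : iIndepFun X μ) {s : Finset ι} (hs : s.Nonempty) :
    HasLaw (∑ i ∈ s, X i) (gammaMeasure (s.card * a) r) μ := by
  induction hs using Finset.Nonempty.cons_induction with
  | singleton i => simpa using hX i
  | cons i s hi hs ih =>
    have hsa : 0 < s.card * a := mul_pos (Nat.cast_pos.2 hs.card_pos) ha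
    have := isProbabilityMeasure_gammaMeasure ha hr
    have := isProbabilityMeasure_gammaMeasure hsa hr
    have h := (hind.indepFun_finsetSum_of_notMem₀ (fun j => (hX j).aemeasurable) hi).hasLaw_add
      ih (hX i)
    rw [gammaMeasure_conv_gammaMeasure hsa ha hr] at h
    rw [Finset.sum_cons, add_comm, Finset.card_cons]
    convert h using 2
    push_cast
    ring

end GammaMeasure

/-! ### Complex Gaussian vectors -/

section ComplexGaussian

theorem integral_comp_sq_gaussianReal {v : ℝ≥0} (hv : v ≠ 0) (f : ℝ → ℝ) :
    ∫ x, f (x ^ 2) ∂gaussianReal 0 v = ∫ x, f x ∂gammaMeasure (1 / 2) (1 / (2 * v)) := by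
  have heven (x : ℝ) : gaussianPDFReal 0 v x • f (x ^ 2) =
      gaussianPDFReal 0 v |x| • f (|x| ^ 2) := by simp [gaussianPDFReal]
  have hsubst (x : ℝ) (hx : 0 < x) : 2 * (gaussianPDFReal 0 v x • f (x ^ 2)) =
      (2 * x ^ ((2 : ℝ) - 1)) • (gammaPDFReal (1 / 2) (1 / (2 * v)) (x ^ (2 : ℝ)) •
        f (x ^ (2 : ℝ))) := by
    have hpow : (x ^ 2) ^ ((1 : ℝ) / 2 - 1) = x⁻¹ := by
      rw [← rpow_natCast, ← rpow_mul hx.le, ← rpow_neg_one]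
      norm_num
    rw [rpow_two, gammaPDFReal_of_pos (by positivity), hpow, Gamma_one_half_eq, gaussianPDFReal,
      ← sqrt_eq_rpow, sqrt_div zero_le_one, sqrt_one, mul_right_comm 2 π, sqrt_mul' _ pi_pos.le,
      show (2 : ℝ) - 1 = 1 by norm_num, rpow_one]
    simp only [smul_eq_mul, sub_zero]
    field_simp
  rw [integral_gaussianReal_eq_integral_smul hv, integral_gammaMeasure (by positivity)
    (by positivity), ← integral_comp_rpow_Ioi_of_pos two_pos]
  rw [integral_congr_ae (.of_forall heven),
    integral_comp_abs (f := fun x => gaussianPDFReal 0 v x • f (x ^ 2)), ← integral_const_mul]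
  exact setIntegral_congr_fun measurableSet_Ioi hsubst

theorem hasLaw_sq_gaussianReal {v : ℝ≥0} (hv : v ≠ 0) :
    HasLaw (fun x => x ^ 2) (gammaMeasure (1 / 2) (1 / (2 * v))) (gaussianReal 0 v) where
  map_eq := by
    have : IsProbabilityMeasure (gammaMeasure (1 / 2) (1 / (2 * v))) :=
      isProbabilityMeasure_gammaMeasure (by positivity) (by positivity)
    have : IsProbabilityMeasure ((gaussianReal 0 v).map fun x => x ^ 2) :=
      Measure.isProbabilityMeasure_map (by fun_prop)
    refine ext_of_forall_integral_eq_of_IsFiniteMeasure fun f => ?_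
    rw [integral_map (by fun_prop) (by fun_prop), integral_comp_sq_gaussianReal hv]

instance isProbabilityMeasure_complexGaussian (v : ℝ≥0) :
    IsProbabilityMeasure (complexGaussian v) :=
  Measure.isProbabilityMeasure_map (by fun_prop)

instance isProbabilityMeasure_complexGaussianVec (N : ℕ) :
    IsProbabilityMeasure (complexGaussianVec N) :=
  Measure.isProbabilityMeasure_map (by fun_prop)

theorem hasLaw_re_add_im_complexGaussian (v : ℝ≥0) :
    HasLaw (fun p : ℝ × ℝ => (p.1 : ℂ) + (p.2 : ℂ) * I) (complexGaussian v)
      ((gaussianReal 0 (v / 2)).prod (gaussianReal 0 (v / 2))) where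
  map_eq := rfl

theorem hasLaw_normSq_complexGaussian {v : ℝ≥0} (hv : v ≠ 0) :
    HasLaw (fun z => ‖z‖ ^ 2) (gammaMeasure 1 (1 / v)) (complexGaussian v) := by
  have hsq := hasLaw_sq_gaussianReal (half_pos (pos_of_ne_zero hv)).ne'
  have hr : (0 : ℝ) < 1 / (2 * (v / 2 : ℝ≥0)) := by positivity
  have := isProbabilityMeasure_gammaMeasure (a := 1 / 2) (by positivity) hr
  have hadd := (indepFun_prod (μ := gaussianReal 0 (v / 2)) (ν := gaussianReal 0 (v / 2))
    (measurable_id.pow_const 2) (measurable_id.pow_const 2)).hasLaw_add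
    (hsq.comp measurePreserving_fst.hasLaw) (hsq.comp measurePreserving_snd.hasLaw)
  rw [gammaMeasure_conv_gammaMeasure (by positivity) (by positivity) hr] at hadd
  refine .comp_of_hasLaw_comp (f := fun z : ℂ => ‖z‖ ^ 2) (by fun_prop)
    (hasLaw_re_add_im_complexGaussian v) .id ?_
  convert hadd using 1
  · ext p
    simp [Complex.sq_norm, Complex.normSq_add_mul_I]
  · norm_num

theorem hasLaw_ofLp_complexGaussianVec (N : ℕ) :
    HasLaw WithLp.ofLp (Measure.pi fun _ : Fin N => complexGaussian 1) (complexGaussianVec N) where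
  map_eq := by
    rw [complexGaussianVec, Measure.map_map (by fun_prop) (by fun_prop)]
    exact Measure.map_id

variable {N : ℕ}

theorem hasLaw_apply_complexGaussianVec (j : Fin N) :
    HasLaw (fun x => x j) (complexGaussian 1) (complexGaussianVec N) :=
  (measurePreserving_eval _ j).comp_hasLaw (hasLaw_ofLp_complexGaussianVec N)

theorem iIndepFun_apply_complexGaussianVec :
    iIndepFun (fun (j : Fin N) (x : EuclideanSpace ℂ (Fin N)) => x j) (complexGaussianVec N) :=
  (iIndepFun_iff_hasLaw_pi_pi hasLaw_apply_complexGaussianVec).2 (hasLaw_ofLp_complexGaussianVec N)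

theorem hasLaw_normSq_complexGaussianVec (hN : N ≠ 0) :
    HasLaw (fun x => ‖x‖ ^ 2) (gammaMeasure N 1) (complexGaussianVec N) := by
  have : Nonempty (Fin N) := Fin.pos_iff_nonempty.1 (Nat.pos_of_ne_zero hN)
  have hcoord (j : Fin N) : HasLaw (fun x : EuclideanSpace ℂ (Fin N) => ‖x j‖ ^ 2)
      (gammaMeasure 1 1) (complexGaussianVec N) := by
    simpa using! (hasLaw_normSq_complexGaussian one_ne_zero).comp
      (hasLaw_apply_complexGaussianVec j)
  have hsum := hasLaw_sum_gammaMeasure one_pos one_pos hcoord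
    (iIndepFun_apply_complexGaussianVec.comp (fun _ z => ‖z‖ ^ 2) (by fun_prop))
    Finset.univ_nonempty
  rw [Finset.card_univ, Fintype.card_fin, mul_one] at hsum
  refine hsum.congr (.of_forall fun x => ?_)
  simp only [EuclideanSpace.norm_sq_eq, Finset.sum_apply]

end ComplexGaussian

/-! ### Stirling's formula with a relative error bound -/

section Stirling

variable {n : ℕ}

theorem stirlingSeq_le_sqrt_pi_mul_exp (hn : n ≠ 0) :
    Stirling.stirlingSeq n ≤ √π * exp (1 / (12 * n)) := by
  -- `log (stirlingSeq n) - 1 / (12 n)` increases to `log √π`.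
  have hmono : Monotone fun k : ℕ =>
      log (Stirling.stirlingSeq (k + 1)) - 1 / (12 * ((k : ℝ) + 1)) := by
    refine monotone_nat_of_le_succ fun k => ?_
    have hstep := Stirling.log_stirlingSeq_sdiff_le (k + 1)
    have htel : (1 : ℝ) / (12 * ((k + 1 : ℕ) : ℝ) * (((k + 1 : ℕ) : ℝ) + 1)) =
        1 / (12 * ((k : ℝ) + 1)) - 1 / (12 * (((k + 1 : ℕ) : ℝ) + 1)) := by
      push_cast
      field_simp
      ring
    rw [htel] at hstep
    linarith
  have hlim : Tendsto (fun k : ℕ =>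
      log (Stirling.stirlingSeq (k + 1)) - 1 / (12 * ((k : ℝ) + 1))) atTop (𝓝 (log √π - 0)) := by
    refine ((Stirling.tendsto_stirlingSeq_sqrt_pi.comp (tendsto_add_atTop_nat 1)).log
      (by positivity)).sub ?_
    simpa [mul_comm] using (tendsto_one_div_add_atTop_nhds_zero_nat (𝕜 := ℝ)).const_mul 12⁻¹
  obtain ⟨k, rfl⟩ := Nat.exists_eq_succ_of_ne_zero hn
  have h := hmono.ge_of_tendsto hlim k
  rw [← log_le_log_iff (Stirling.stirlingSeq'_pos k) (by positivity),
    log_mul (by positivity) (by positivity), log_exp]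
  push_cast
  linarith

theorem stirling_le_factorial_mul_exp (hn : n ≠ 0) :
    n.factorial ≤ √(2 * π * n) * (n / exp 1) ^ n * exp (1 / (12 * n)) := by
  have h := stirlingSeq_le_sqrt_pi_mul_exp hn
  rw [Stirling.stirlingSeq, div_le_iff₀ (by positivity)] at h
  rw [mul_right_comm 2 π, sqrt_mul' _ pi_pos.le]
  linarith

theorem stirling_div_factorial_le_one (n : ℕ) :
    √(2 * π * n) * (n / exp 1) ^ n / n.factorial ≤ 1 :=
  div_le_one_of_le₀ (Stirling.le_factorial_stirling n) (by positivity)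

theorem le_stirling_div_factorial (hn : n ≠ 0) :
    1 - 1 / (12 * (n : ℝ)) ≤ √(2 * π * n) * (n / exp 1) ^ n / n.factorial := by
  have hlower : n.factorial * exp (-(1 / (12 * n))) ≤ √(2 * π * n) * (n / exp 1) ^ n := by
    rw [exp_neg, ← div_eq_mul_inv, div_le_iff₀ (by positivity)]
    exact stirling_le_factorial_mul_exp hn
  rw [le_div_iff₀' (by positivity)]
  refine (mul_le_mul_of_nonneg_left ?_ (by positivity)).trans hlower
  exact one_sub_le_exp_neg _

end Stirling

/-! ### The normalized dispersion -/

section NormDispersion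

/-- The channel dispersion in units of `(log₂ e)²`; the rate loss is a constant multiple of its
square root. -/
noncomputable def normDispersion (y : ℝ) : ℝ := 1 - ((1 + y) ^ 2)⁻¹

theorem normDispersion_eq_div {y : ℝ} (hy : 0 ≤ y) :
    normDispersion y = y * (2 + y) / (1 + y) ^ 2 := by
  rw [normDispersion]
  field_simp
  ring

theorem normDispersion_nonneg {y : ℝ} (hy : 0 ≤ y) : 0 ≤ normDispersion y := by
  rw [normDispersion_eq_div hy]
  positivity

theorem normDispersion_pos {y : ℝ} (hy : 0 < y) : 0 < normDispersion y := by
  rw [normDispersion_eq_div hy.le]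
  positivity

theorem normDispersion_le_one (y : ℝ) : normDispersion y ≤ 1 :=
  sub_le_self _ (by positivity)

theorem measurable_normDispersion : Measurable normDispersion := by
  unfold normDispersion
  fun_prop

/-- The elasticity `y f'(y) / f(y)` of `f = √normDispersion`, hence the slope at `r = 1` of
`r ↦ f (y r) / f y`. -/
noncomputable def dispersionSlope (y : ℝ) : ℝ := 1 / ((2 + y) * (1 + y))

theorem dispersionSlope_nonneg {y : ℝ} (hy : 0 ≤ y) : 0 ≤ dispersionSlope y := by
  unfold dispersionSlope
  positivity

theorem dispersionSlope_le_one {y : ℝ} (hy : 0 ≤ y) : dispersionSlope y ≤ 1 :=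
  div_le_one_of_le₀ (by nlinarith) (by positivity)

variable {y r : ℝ}

theorem normDispersion_mul_div_nonneg (hy : 0 < y) (hr : 0 ≤ r) :
    0 ≤ normDispersion (y * r) / normDispersion y :=
  div_nonneg (normDispersion_nonneg (by positivity)) (normDispersion_pos hy).le

theorem normDispersion_mul_div_sub_one (hy : 0 < y) (hr : 0 ≤ r) :
    normDispersion (y * r) / normDispersion y - 1 =
      (r - 1) * ((2 + y + y * r) / ((2 + y) * (1 + y * r) ^ 2)) := by
  rw [normDispersion_eq_div hy.le, normDispersion_eq_div (by positivity)]
  field_simp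
  ring

theorem sq_normDispersion_mul_div_sub_one_le (hy : 0 < y) (hr : 0 ≤ r) :
    (normDispersion (y * r) / normDispersion y - 1) ^ 2 ≤ (r - 1) ^ 2 := by
  have hfactor : (2 + y + y * r) / ((2 + y) * (1 + y * r) ^ 2) ≤ 1 := by
    have hyr : 0 ≤ y * r := by positivity
    refine div_le_one_of_le₀ ?_ (by positivity)
    nlinarith [mul_nonneg hyr hy.le, mul_nonneg hyr hyr, mul_nonneg hy.le (mul_nonneg hyr hyr)]
  rw [normDispersion_mul_div_sub_one hy hr, mul_pow]
  exact mul_le_of_le_one_right (sq_nonneg _) (pow_le_one₀ (by positivity) hfactor)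

theorem normDispersion_mul_div_eq (hy : 0 < y) (hr : 0 ≤ r) :
    normDispersion (y * r) / normDispersion y = 1 + 2 * dispersionSlope y * (r - 1) -
      y * (3 + y + 2 * (y * r)) / ((2 + y) * (1 + y) * (1 + y * r) ^ 2) * (r - 1) ^ 2 := by
  rw [← sub_left_inj (a := (1 : ℝ)), normDispersion_mul_div_sub_one hy hr, dispersionSlope]
  field_simp
  ring

theorem normDispersion_mul_div_le (hy : 0 < y) (hr : 0 ≤ r) :
    normDispersion (y * r) / normDispersion y ≤ 1 + 2 * dispersionSlope y * (r - 1) := by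
  rw [normDispersion_mul_div_eq hy hr]
  exact sub_le_self _ (by positivity)

theorem le_normDispersion_mul_div (hy : 0 < y) (hr : 0 ≤ r) :
    1 + 2 * dispersionSlope y * (r - 1) - 3 * (r - 1) ^ 2 ≤
      normDispersion (y * r) / normDispersion y := by
  have hcoeff : y * (3 + y + 2 * (y * r)) / ((2 + y) * (1 + y) * (1 + y * r) ^ 2) ≤ 3 := by
    have hyr : 0 ≤ y * r := by positivity
    have hle : y * (3 + y + 2 * (y * r)) ≤ (2 + y) * (3 * ((1 + y) * (1 + y * r) ^ 2)) := by
      gcongr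
      · linarith
      · nlinarith [mul_nonneg hy.le hyr, mul_nonneg hy.le (mul_nonneg hyr hyr)]
    rw [div_le_iff₀ (by positivity)]
    linarith
  rw [normDispersion_mul_div_eq hy hr]
  gcongr

theorem one_add_half_sub_sq_le_sqrt {q : ℝ} (hq : 0 ≤ q) :
    1 + (q - 1) / 2 - (q - 1) ^ 2 / 2 ≤ √q := by
  obtain ⟨s, hs, rfl⟩ : ∃ s : ℝ, 0 ≤ s ∧ q = s ^ 2 := ⟨√q, sqrt_nonneg q, (sq_sqrt hq).symm⟩
  have hgap : 0 ≤ (s - 1) ^ 2 / 2 * (s * (s + 2)) := by positivity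
  rw [sqrt_sq hs]
  linarith

theorem sqrt_normDispersion_mul_eq (hy : 0 < y) (r : ℝ) :
    √(normDispersion (y * r)) =
      √(normDispersion (y * r) / normDispersion y) * √(normDispersion y) := by
  rw [← sqrt_mul' _ (normDispersion_pos hy).le, div_mul_cancel₀ _ (normDispersion_pos hy).ne']

theorem sqrt_normDispersion_mul_le (hy : 0 < y) (hr : 0 ≤ r) :
    √(normDispersion (y * r)) ≤ (1 + dispersionSlope y * (r - 1)) * √(normDispersion y) := by
  rw [sqrt_normDispersion_mul_eq hy]
  gcongr
  have hq := normDispersion_mul_div_le hy hr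
  have hsqrt := sqrt_one_add_le (x := normDispersion (y * r) / normDispersion y - 1)
    (by linarith [normDispersion_mul_div_nonneg hy hr])
  rw [add_sub_cancel] at hsqrt
  linarith

theorem le_sqrt_normDispersion_mul (hy : 0 < y) (hr : 0 ≤ r) :
    (1 + dispersionSlope y * (r - 1) - 2 * (r - 1) ^ 2) * √(normDispersion y) ≤
      √(normDispersion (y * r)) := by
  rw [sqrt_normDispersion_mul_eq hy]
  gcongr
  have hsqrt := one_add_half_sub_sq_le_sqrt (q := normDispersion (y * r) / normDispersion y)
    (normDispersion_mul_div_nonneg hy hr)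
  linarith [le_normDispersion_mul_div hy hr, sq_normDispersion_mul_div_sub_one_le hy hr]

end NormDispersion

/-! ### Laplace's method for the dispersion term -/

section LaplaceMethod

variable {γ : ℝ}

section Mode

variable {c : ℝ}

theorem integral_sq_gammaMeasure (hc : 0 < c) :
    ∫ x, x ^ 2 ∂gammaMeasure c 1 = (c + 1) * c := by
  have h := integral_pow_gammaMeasure hc one_pos 2
  rw [Nat.cast_two, show c + 2 = c + 1 + 1 by ring, Gamma_add_one (by positivity),
    Gamma_add_one hc.ne'] at h
  have := (Gamma_pos_of_pos hc).ne'
  rw [h]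
  field_simp

theorem integral_id_gammaMeasure (hc : 0 < c) : ∫ x, x ∂gammaMeasure c 1 = c := by
  have h := integral_pow_gammaMeasure hc one_pos 1
  simp only [pow_one, Nat.cast_one, mul_one] at h
  rw [h, Gamma_add_one hc.ne', mul_div_cancel_right₀ _ (Gamma_pos_of_pos hc).ne']

theorem quadratic_eq_add_mul_add_mul (hc : c ≠ 0) (α β x : ℝ) :
    1 + α * (x / c - 1) - β * (x / c - 1) ^ 2 =
      (1 - α - β) + (α + 2 * β) / c * x + -(β / c ^ 2) * x ^ 2 := by
  field_simp
  ring

theorem integrable_quadratic_gammaMeasure (hc : 0 < c) (α β : ℝ) :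
    Integrable (fun x => 1 + α * (x / c - 1) - β * (x / c - 1) ^ 2) (gammaMeasure (c + 1) 1) := by
  have hc' : 0 < c + 1 := by positivity
  have := isProbabilityMeasure_gammaMeasure hc' one_pos
  have hid := integrable_pow_gammaMeasure hc' one_pos 1
  simp only [pow_one] at hid
  simp only [quadratic_eq_add_mul_add_mul hc.ne']
  exact ((integrable_const _).add (hid.const_mul _)).add
    ((integrable_pow_gammaMeasure hc' one_pos 2).const_mul _)

theorem integral_quadratic_gammaMeasure (hc : 0 < c) (α β : ℝ) :
    ∫ x, (1 + α * (x / c - 1) - β * (x / c - 1) ^ 2) ∂gammaMeasure (c + 1) 1 =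
      1 + α / c - β * (c + 2) / c ^ 2 := by
  have hc' : 0 < c + 1 := by positivity
  have := isProbabilityMeasure_gammaMeasure hc' one_pos
  have hid := (integrable_pow_gammaMeasure hc' one_pos 1).const_mul ((α + 2 * β) / c)
  have hsq := (integrable_pow_gammaMeasure hc' one_pos 2).const_mul (-(β / c ^ 2))
  simp only [pow_one] at hid
  have haff : Integrable (fun x => 1 - α - β + (α + 2 * β) / c * x) (gammaMeasure (c + 1) 1) :=
    (integrable_const _).add hid
  simp only [quadratic_eq_add_mul_add_mul hc.ne']
  rw [integral_add haff hsq, integral_add (integrable_const _) hid,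
    integral_const_mul, integral_const_mul, integral_id_gammaMeasure hc',
    integral_sq_gammaMeasure hc']
  simp only [integral_const, probReal_univ, one_smul]
  field_simp
  ring

theorem integrable_sqrt_normDispersion {α : Type*} [MeasurableSpace α] {μ : Measure α}
    [IsFiniteMeasure μ] {f : α → ℝ} (hf : AEMeasurable f μ) :
    Integrable (fun x => √(normDispersion (f x))) μ := by
  refine .of_bound
    (measurable_normDispersion.comp_aemeasurable hf).sqrt.aestronglyMeasurable 1
    (.of_forall fun x => ?_)
  rw [norm_of_nonneg (sqrt_nonneg _)]
  exact sqrt_le_one.2 (normDispersion_le_one _)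

theorem integral_sqrt_normDispersion_le (hγ : 0 < γ) (hc : 0 < c) :
    ∫ x, √(normDispersion (γ * x)) ∂gammaMeasure (c + 1) 1 ≤
      (1 + dispersionSlope (γ * c) / c) * √(normDispersion (γ * c)) := by
  have := isProbabilityMeasure_gammaMeasure (by positivity : 0 < c + 1) one_pos
  have hbound : ∀ᵐ x ∂gammaMeasure (c + 1) 1, √(normDispersion (γ * x)) ≤
      (1 + dispersionSlope (γ * c) * (x / c - 1) - 0 * (x / c - 1) ^ 2) *
        √(normDispersion (γ * c)) := by
    filter_upwards [ae_gammaMeasure_pos (c + 1) 1] with x hx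
    have h := sqrt_normDispersion_mul_le (by positivity : 0 < γ * c) (by positivity : 0 ≤ x / c)
    rwa [mul_assoc, mul_div_cancel₀ x hc.ne', ← sub_zero (1 + _),
      ← zero_mul ((x / c - 1) ^ 2)] at h
  refine (integral_mono_ae (integrable_sqrt_normDispersion (by fun_prop))
    ((integrable_quadratic_gammaMeasure hc _ _).mul_const _) hbound).trans_eq ?_
  rw [integral_mul_const, integral_quadratic_gammaMeasure hc, zero_mul, zero_div, sub_zero]

theorem le_integral_sqrt_normDispersion (hγ : 0 < γ) (hc : 0 < c) :
    (1 + dispersionSlope (γ * c) / c - 2 * (c + 2) / c ^ 2) * √(normDispersion (γ * c)) ≤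
      ∫ x, √(normDispersion (γ * x)) ∂gammaMeasure (c + 1) 1 := by
  have := isProbabilityMeasure_gammaMeasure (by positivity : 0 < c + 1) one_pos
  have hbound : ∀ᵐ x ∂gammaMeasure (c + 1) 1,
      (1 + dispersionSlope (γ * c) * (x / c - 1) - 2 * (x / c - 1) ^ 2) *
        √(normDispersion (γ * c)) ≤ √(normDispersion (γ * x)) := by
    filter_upwards [ae_gammaMeasure_pos (c + 1) 1] with x hx
    have h := le_sqrt_normDispersion_mul (by positivity : 0 < γ * c) (by positivity : 0 ≤ x / c)
    rwa [mul_assoc γ c, mul_div_cancel₀ x hc.ne'] at h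
  refine Eq.trans_le ?_ (integral_mono_ae ((integrable_quadratic_gammaMeasure hc _ _).mul_const _)
    (integrable_sqrt_normDispersion (by fun_prop)) hbound)
  rw [integral_mul_const, integral_quadratic_gammaMeasure hc]

theorem abs_integral_sqrt_normDispersion_sub_le (hγ : 0 < γ) (hc : 1 ≤ c) :
    |∫ x, √(normDispersion (γ * x)) ∂gammaMeasure (c + 1) 1 - √(normDispersion (γ * c))| ≤
      6 / c * √(normDispersion (γ * c)) := by
  have hc0 : 0 < c := one_pos.trans_le hc
  have hγc : 0 ≤ γ * c := by positivity
  have hslope0 : 0 ≤ dispersionSlope (γ * c) / c :=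
    div_nonneg (dispersionSlope_nonneg hγc) hc0.le
  have hslope6 : dispersionSlope (γ * c) / c ≤ 6 / c := by
    gcongr
    linarith [dispersionSlope_le_one hγc]
  have hquad : 2 * (c + 2) / c ^ 2 ≤ 6 / c := by
    rw [div_le_div_iff₀ (by positivity) hc0]
    nlinarith
  have hsqrt := sqrt_nonneg (normDispersion (γ * c))
  rw [abs_sub_le_iff]
  constructor
  · linarith [integral_sqrt_normDispersion_le hγ hc0,
      mul_le_mul_of_nonneg_right hslope6 hsqrt]
  · linarith [le_integral_sqrt_normDispersion hγ hc0, mul_nonneg hslope0 hsqrt,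
      mul_le_mul_of_nonneg_right hquad hsqrt]

end Mode

section RateLoss

variable (T : ℕ) (ε : ℝ)

theorem rateLoss_eq (y : ℝ) :
    rateLoss T ε y = √(1 / T) * (Qinv ε / log 2) * √(normDispersion y) := by
  rw [rateLoss, dispersion, ← mul_assoc, sqrt_mul (by positivity), sqrt_mul (by positivity),
    sqrt_sq_eq_abs, logb, log_exp, abs_of_pos (by positivity), normDispersion]
  ring

theorem measurable_rateLoss : Measurable (rateLoss T ε) := by
  unfold rateLoss dispersion
  fun_prop

theorem integrable_rateLoss {α : Type*} [MeasurableSpace α] {μ : Measure α} [IsFiniteMeasure μ]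
    {f : α → ℝ} (hf : AEMeasurable f μ) :
    Integrable (fun x => rateLoss T ε (f x)) μ := by
  simp only [rateLoss_eq]
  exact (integrable_sqrt_normDispersion hf).const_mul _

theorem Psi_add_one {n : ℕ} (hn : n ≠ 0) (γ : ℝ) :
    Psi γ (n + 1) T ε = √(1 / T) * (Qinv ε / log 2) *
      (√(2 * π * n) * (n / exp 1) ^ n / n.factorial * √(normDispersion (γ * n))) := by
  have hn' : (0 : ℝ) < n := by positivity
  have hlog : log 2 ≠ 0 := (log_pos one_lt_two).ne'
  have hT : √(2 * π / T) = √(2 * π) * √(1 / T) := by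
    rw [← sqrt_mul (by positivity), mul_one_div]
  have hexp : exp 1 ^ n = exp n := by rw [← exp_nat_mul, mul_one]
  rw [Psi, Nat.cast_add_one, add_sub_cancel_right, show (n + 1 - 1 / 2 : ℝ) = n + 1 / 2 by ring,
    hT, Gamma_nat_eq_factorial, rpow_add hn', rpow_natCast, ← sqrt_eq_rpow,
    sqrt_mul (by positivity) (n : ℝ), div_pow, hexp, exp_neg, normDispersion]
  field_simp

theorem abs_sub_mul_le_of_abs_sub_le {c I M S : ℝ} (hc : 1 ≤ c) (hM : 0 ≤ M)
    (hI : |I - M| ≤ 6 / c * M) (hS : 1 - 1 / (12 * c) ≤ S) (hS1 : S ≤ 1) :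
    |I - S * M| ≤ 7 / c * (S * M) := by
  have hS11 : 11 / 12 ≤ S := by
    have : 1 / (12 * c) ≤ 1 / 12 := by
      gcongr
      linarith
    linarith
  calc |I - S * M| = |(I - M) + (1 - S) * M| := by ring_nf
    _ ≤ |I - M| + |(1 - S) * M| := abs_add_le _ _
    _ ≤ 6 / c * M + 1 / (12 * c) * M := by
        rw [abs_of_nonneg (mul_nonneg (sub_nonneg.2 hS1) hM)]
        gcongr
        linarith
    _ = 73 / 12 * (M / c) := by
        field_simp
        norm_num
    _ ≤ 7 * S * (M / c) := by
        gcongr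
        linarith
    _ = 7 / c * (S * M) := by ring

theorem abs_integral_rateLoss_sub_Psi_le (hγ : 0 < γ) {N : ℕ} (hN : 2 ≤ N) :
    |∫ x, rateLoss T ε (γ * x) ∂gammaMeasure N 1 - Psi γ N T ε| ≤
      7 / ((N : ℝ) - 1) * |Psi γ N T ε| := by
  obtain ⟨n, rfl⟩ := Nat.exists_eq_add_of_le' (one_le_two.trans hN)
  have hn : n ≠ 0 := by lia
  have hn1 : (1 : ℝ) ≤ n := by exact_mod_cast Nat.one_le_iff_ne_zero.2 hn
  have hrel := abs_sub_mul_le_of_abs_sub_le hn1 (sqrt_nonneg _)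
    (abs_integral_sqrt_normDispersion_sub_le hγ hn1) (le_stirling_div_factorial hn)
    (stirling_div_factorial_le_one n)
  have hpos : 0 ≤ √(2 * π * n) * (n / exp 1) ^ n / n.factorial * √(normDispersion (γ * n)) := by
    positivity
  rw [Psi_add_one T ε hn, Nat.cast_add_one, add_sub_cancel_right]
  simp only [rateLoss_eq, integral_const_mul]
  rw [← mul_sub, abs_mul, abs_mul (√_ * _), abs_of_nonneg hpos, mul_left_comm (7 / _)]
  gcongr

end RateLoss

end LaplaceMethod

/-! ### Mellin inversion of Laplace transforms -/

section LaplaceTransform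

variable {E : Type*} [NormedAddCommGroup E] [NormedSpace ℂ E] {g : ℝ → E} {w : ℂ} {x : ℝ}

/-- The Laplace transform of a function on `(0, ∞)`, as a function of a real variable. -/
noncomputable def laplaceTransform (g : ℝ → E) (x : ℝ) : E := ∫ t in Ioi 0, exp (-(x * t)) • g t

theorem exp_neg_mul_mul_rpow_le {r t : ℝ} (hr : 0 < r) (hx : 0 < x) (ht : 0 < t) :
    exp (-(x * t)) * t ^ r ≤ (r / x) ^ r := by
  have h : x * t / r ≤ exp (x * t / r) := by linarith [add_one_le_exp (x * t / r)]
  have hpow : (x * t / r) ^ r ≤ exp (x * t) := by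
    refine (rpow_le_rpow (by positivity) h hr.le).trans_eq ?_
    rw [← exp_mul, div_mul_cancel₀ _ hr.ne']
  calc exp (-(x * t)) * t ^ r = exp (-(x * t)) * ((x * t / r) ^ r * (r / x) ^ r) := by
        rw [← mul_rpow (by positivity) (by positivity)]
        field_simp
    _ ≤ exp (-(x * t)) * (exp (x * t) * (r / x) ^ r) := by gcongr
    _ = (r / x) ^ r := by rw [← mul_assoc, ← exp_add, neg_add_cancel, exp_zero, one_mul]

theorem aestronglyMeasurable_of_mellinConvergent {s : ℂ} (hg : MellinConvergent g s) :
    AEStronglyMeasurable g (volume.restrict (Ioi 0)) := by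
  have hpow : Measurable fun t : ℝ => (t : ℂ) ^ (1 - s) := by fun_prop
  refine (hpow.aestronglyMeasurable.smul hg.aestronglyMeasurable).congr ?_
  filter_upwards [ae_restrict_mem measurableSet_Ioi] with t ht
  rw [Pi.smul_apply', smul_smul, ← Complex.cpow_add _ _ (Complex.ofReal_ne_zero.2 (ne_of_gt ht)),
    sub_add_sub_cancel', sub_self, Complex.cpow_zero, one_smul]

theorem integrableOn_exp_neg_mul_smul (hw : 0 < w.re) (hg : MellinConvergent g (1 - w))
    (hx : 0 < x) : IntegrableOn (fun t => exp (-(x * t)) • g t) (Ioi 0) := by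
  have hbound : ∀ᵐ t : ℝ ∂volume.restrict (Ioi 0),
      ‖(exp (-(x * t)) : ℂ) * (t : ℂ) ^ w‖ ≤ (w.re / x) ^ w.re := by
    filter_upwards [ae_restrict_mem measurableSet_Ioi] with t ht
    rw [norm_mul, Complex.norm_real, norm_of_nonneg (exp_pos _).le,
      Complex.norm_cpow_eq_rpow_re_of_pos ht]
    exact exp_neg_mul_mul_rpow_le hw hx ht
  have hmeas : Measurable fun t : ℝ => (exp (-(x * t)) : ℂ) * (t : ℂ) ^ w := by fun_prop
  refine IntegrableOn.congr_fun (hg.bdd_smul _ hmeas.aestronglyMeasurable hbound)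
    (fun t ht => ?_) measurableSet_Ioi
  have ht0 : (t : ℂ) ≠ 0 := Complex.ofReal_ne_zero.2 (ne_of_gt ht)
  rw [Pi.smul_apply', smul_smul, sub_sub_cancel_left, mul_assoc,
    ← Complex.cpow_add _ _ ht0, add_neg_cancel, Complex.cpow_zero, mul_one, Complex.coe_smul]

theorem continuousAt_laplaceTransform (hw : 0 < w.re) (hg : MellinConvergent g (1 - w))
    (hx : 0 < x) : ContinuousAt (laplaceTransform g) x := by
  have hpos : ∀ᶠ y in 𝓝 x, x / 2 < y := lt_mem_nhds (half_lt_self hx)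
  refine continuousAt_of_dominated (bound := fun t => ‖exp (-(x / 2 * t)) • g t‖) ?_ ?_
    (integrableOn_exp_neg_mul_smul hw hg (half_pos hx)).norm ?_
  · filter_upwards [hpos] with y hy
    exact (integrableOn_exp_neg_mul_smul hw hg ((half_pos hx).trans hy)).aestronglyMeasurable
  · filter_upwards [hpos] with y hy
    filter_upwards [ae_restrict_mem measurableSet_Ioi] with t ht
    have : 0 < t := ht
    rw [norm_smul, norm_smul, norm_of_nonneg (exp_pos _).le, norm_of_nonneg (exp_pos _).le]
    gcongr
  · exact .of_forall fun t => by fun_prop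

theorem integrableOn_rpow_mul_exp_neg_mul {a r : ℝ} (ha : 0 < a) (hr : 0 < r) :
    IntegrableOn (fun t => t ^ (a - 1) * exp (-(r * t))) (Ioi 0) :=
  .of_integral_ne_zero <| by
    rw [integral_rpow_mul_exp_neg_mul_Ioi ha hr]
    have := Gamma_pos_of_pos ha
    positivity

theorem norm_cpow_mul_exp_neg_mul {t : ℝ} (hx : 0 < x) :
    ‖(x : ℂ) ^ (w - 1) * Complex.exp (-(t * x))‖ = x ^ (w.re - 1) * exp (-(t * x)) := by
  rw [norm_mul, Complex.norm_cpow_eq_rpow_re_of_pos hx, Complex.norm_exp]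
  simp

theorem integrableOn_cpow_mul_exp_neg_mul {t : ℝ} (hw : 0 < w.re) (ht : 0 < t) :
    IntegrableOn (fun x : ℝ => (x : ℂ) ^ (w - 1) * Complex.exp (-(t * x))) (Ioi 0) := by
  refine (integrableOn_rpow_mul_exp_neg_mul hw ht).mono' (by fun_prop) ?_
  filter_upwards [ae_restrict_mem measurableSet_Ioi] with x hx
  exact (norm_cpow_mul_exp_neg_mul hx).le

theorem integral_norm_cpow_mul_exp_neg_mul {t : ℝ} (hw : 0 < w.re) (ht : 0 < t) :
    ∫ x in Ioi (0 : ℝ), ‖(x : ℂ) ^ (w - 1) * Complex.exp (-(t * x))‖ =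
      Gamma w.re * ‖(t : ℂ) ^ (-w)‖ := by
  rw [setIntegral_congr_fun measurableSet_Ioi fun x hx => norm_cpow_mul_exp_neg_mul hx,
    integral_rpow_mul_exp_neg_mul_Ioi hw ht, Complex.norm_cpow_eq_rpow_re_of_pos ht, Complex.neg_re,
    rpow_neg ht.le, one_div, inv_rpow ht.le, mul_comm]

theorem integral_cpow_mul_exp_neg_mul {t : ℝ} (hw : 0 < w.re) (ht : 0 < t) :
    ∫ x in Ioi (0 : ℝ), (x : ℂ) ^ (w - 1) * Complex.exp (-(t * x)) =
      Complex.Gamma w * (t : ℂ) ^ (-w) := by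
  rw [Complex.integral_cpow_mul_exp_neg_mul_Ioi hw ht, one_div, Complex.inv_cpow _ _
    (by simpa [Complex.arg_ofReal_of_nonneg ht.le] using pi_pos.ne), ← Complex.cpow_neg, mul_comm]

theorem integrable_cpow_mul_exp_neg_mul_smul (hw : 0 < w.re) (hg : MellinConvergent g (1 - w)) :
    Integrable (fun p : ℝ × ℝ => ((p.1 : ℂ) ^ (w - 1) * Complex.exp (-(p.2 * p.1))) • g p.2)
      ((volume.restrict (Ioi 0)).prod (volume.restrict (Ioi 0))) := by
  have hmeas : AEStronglyMeasurable g (volume.restrict (Ioi 0)) :=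
    aestronglyMeasurable_of_mellinConvergent hg
  have hker : Measurable fun p : ℝ × ℝ => (p.1 : ℂ) ^ (w - 1) * Complex.exp (-(p.2 * p.1)) := by
    fun_prop
  refine (integrable_prod_iff' (hker.aestronglyMeasurable.smul hmeas.comp_snd)).2 ⟨?_, ?_⟩
  · filter_upwards [ae_restrict_mem measurableSet_Ioi] with t ht
    exact (integrableOn_cpow_mul_exp_neg_mul hw ht).smul_const (g t)
  · refine IntegrableOn.congr_fun (hg.norm.const_mul (Gamma w.re)) (fun t ht => ?_)
      measurableSet_Ioi
    simp only [Pi.smul_apply', norm_smul]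
    rw [integral_mul_const, integral_norm_cpow_mul_exp_neg_mul hw ht, sub_sub_cancel_left,
      mul_assoc]

theorem integral_cpow_mul_exp_neg_mul_smul (g : ℝ → E) (w : ℂ) (x : ℝ) :
    ∫ t in Ioi (0 : ℝ), ((x : ℂ) ^ (w - 1) * Complex.exp (-(t * x))) • g t =
      (x : ℂ) ^ (w - 1) • laplaceTransform g x := by
  simp only [mul_smul, laplaceTransform, integral_smul, ← Complex.coe_smul]
  push_cast
  simp only [mul_comm]

theorem hasMellin_laplaceTransform [CompleteSpace E] (hw : 0 < w.re)
    (hg : MellinConvergent g (1 - w)) :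
    HasMellin (laplaceTransform g) w (Complex.Gamma w • mellin g (1 - w)) := by
  have hint := integrable_cpow_mul_exp_neg_mul_smul hw hg
  refine ⟨hint.integral_prod_left.congr (.of_forall fun x =>
    integral_cpow_mul_exp_neg_mul_smul g w x), ?_⟩
  simp only [mellin, ← integral_cpow_mul_exp_neg_mul_smul, ← integral_smul]
  rw [integral_integral_swap hint]
  refine setIntegral_congr_fun measurableSet_Ioi fun t ht => ?_
  rw [integral_smul_const, integral_cpow_mul_exp_neg_mul hw ht, sub_sub_cancel_left, mul_smul]

end LaplaceTransform

/-! ### The Gamma function on vertical lines -/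

section VerticalLine

theorem norm_Gamma_le {w : ℂ} (hw : 0 < w.re) : ‖Complex.Gamma w‖ ≤ Gamma w.re := by
  rw [Complex.Gamma_eq_integral hw, Complex.GammaIntegral, Gamma_eq_integral hw]
  refine (norm_integral_le_integral_norm _).trans_eq ?_
  refine setIntegral_congr_fun measurableSet_Ioi fun x hx => ?_
  rw [norm_mul, Complex.norm_cpow_eq_rpow_re_of_pos hx, Complex.norm_real,
    norm_of_nonneg (exp_pos _).le, Complex.sub_re, Complex.one_re]

variable {σ : ℝ}

theorem continuous_Gamma_vertical_line (hσ : 0 < σ) :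
    Continuous fun y : ℝ => Complex.Gamma (σ + y * I) := by
  refine continuous_iff_continuousAt.2 fun y =>
    ContinuousAt.comp (f := fun y : ℝ => (σ + y * I : ℂ))
      (Complex.differentiableAt_Gamma _ fun m h => ?_).continuousAt (by fun_prop)
  have hre : σ = -(m : ℝ) := by simpa using congrArg Complex.re h
  linarith [m.cast_nonneg (α := ℝ)]

theorem verticalIntegrable_Gamma_mul (hσ : 0 < σ) {f : ℂ → ℂ}
    (hf : Complex.VerticalIntegrable f σ) :
    Complex.VerticalIntegrable (fun w => Complex.Gamma w * f w) σ := by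
  refine Integrable.bdd_mul (c := Gamma σ) hf
    (continuous_Gamma_vertical_line hσ).aestronglyMeasurable (.of_forall fun y => ?_)
  simpa using norm_Gamma_le (w := σ + y * I) (by simpa using hσ)

theorem verticalIntegrable_one_div_sub_sq {a : ℂ} (hσ : σ ≠ a.re) :
    Complex.VerticalIntegrable (fun w => 1 / (w - a) ^ 2) σ := by
  have hδ : σ - a.re ≠ 0 := sub_ne_zero.2 hσ
  have hint : Integrable fun y : ℝ =>
      ((σ - a.re) ^ 2)⁻¹ * (1 + ((y - a.im) / (σ - a.re)) ^ 2)⁻¹ :=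
    ((integrable_inv_one_add_sq.comp_div hδ).comp_sub_right a.im).const_mul _
  have hmeas : Measurable fun y : ℝ => 1 / ((σ + y * I : ℂ) - a) ^ 2 := by fun_prop
  refine hint.mono' hmeas.aestronglyMeasurable (.of_forall fun y => le_of_eq ?_)
  beta_reduce
  have hsplit : (σ + y * I : ℂ) - a = ((σ - a.re : ℝ) : ℂ) + ((y - a.im : ℝ) : ℂ) * I := by
    apply Complex.ext <;> simp
  rw [hsplit, norm_div, norm_one, norm_pow, Complex.sq_norm, Complex.normSq_add_mul_I, one_div,
    ← mul_inv, div_pow]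
  field_simp

end VerticalLine

/-! ### Mellin transform of the positive logarithm -/

section Mellin

variable {E : Type*} [NormedAddCommGroup E] [NormedSpace ℂ E] {f g : ℝ → E} {s : ℂ} {m : E}

theorem hasMellin_congr (hf : HasMellin f s m) (hfg : EqOn f g (Ioi 0)) : HasMellin g s m := by
  have heq : EqOn (fun t : ℝ => (t : ℂ) ^ (s - 1) • f t) (fun t => (t : ℂ) ^ (s - 1) • g t)
      (Ioi 0) := fun t ht => congrArg _ (hfg ht)
  exact ⟨hf.1.congr_fun heq measurableSet_Ioi,
    (setIntegral_congr_fun measurableSet_Ioi heq).symm.trans hf.2⟩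

theorem mellinInv_congr {f g : ℂ → E} {σ x : ℝ} (h : ∀ w : ℂ, w.re = σ → f w = g w) :
    mellinInv σ f x = mellinInv σ g x := by
  have hline : ∀ y : ℝ, f (σ + y * I) = g (σ + y * I) := fun y => h _ (by simp)
  simp only [mellinInv, hline]

theorem hasMellin_comp_inv (hf : HasMellin f (-s) m) : HasMellin (fun t => f t⁻¹) s m := by
  refine ⟨?_, (mellin_comp_inv f s).trans hf.2⟩
  have h := (MellinConvergent.comp_rpow (f := f) (s := s) (neg_ne_zero.2 one_ne_zero)).2
    (by simpa [div_neg] using hf.1)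
  simpa only [rpow_neg_one] using h

end Mellin

theorem indicator_Ioc_one_eventuallyEq_atTop :
    indicator (Ioc (0 : ℝ) 1) (fun _ => (1 : ℂ)) =ᶠ[atTop] fun _ => 0 := by
  filter_upwards [eventually_gt_atTop 1] with t ht
  exact indicator_of_notMem (fun h => h.2.not_gt ht) _

theorem hasMellin_log_smul_indicator_Ioc {s : ℂ} (hs : 0 < s.re) :
    HasMellin (fun t => log t • indicator (Ioc (0 : ℝ) 1) (fun _ => (1 : ℂ)) t) s
      (-1 / s ^ 2) := by
  set f : ℝ → ℂ := indicator (Ioc 0 1) fun _ => 1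
  have hf : LocallyIntegrableOn f (Ioi 0) :=
    ((locallyIntegrable_const (1 : ℂ)).indicator measurableSet_Ioc).locallyIntegrableOn _
  have htop : f =O[atTop] (· ^ (-(s.re + 1)) : ℝ → ℝ) :=
    indicator_Ioc_one_eventuallyEq_atTop.trans_isBigO (Asymptotics.isBigO_zero _ _)
  have hbot : f =O[𝓝[>] 0] (· ^ (-(0 : ℝ)) : ℝ → ℝ) := by
    simp only [neg_zero, rpow_zero]
    exact Asymptotics.isBigO_of_le _ fun t => by
      simpa using norm_indicator_le_norm_self (s := Ioc (0 : ℝ) 1) (fun _ => (1 : ℂ)) t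
  obtain ⟨hconv, hderiv⟩ :=
    mellin_hasDerivAt_of_isBigO_rpow hf htop (lt_add_one s.re) hbot hs
  have hinv : HasDerivAt (fun w : ℂ => 1 / w) (-1 / s ^ 2) s := by
    simpa [neg_div] using hasDerivAt_inv (x := s) fun h => by simp [h] at hs
  refine ⟨hconv, hderiv.unique (hinv.congr_of_eventuallyEq ?_)⟩
  filter_upwards [(isOpen_lt continuous_const Complex.continuous_re).mem_nhds hs] with w hw
  exact (hasMellin_one_Ioc hw).2

theorem neg_log_inv_smul_indicator_Ioc {t : ℝ} (ht : 0 < t) :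
    (-1 : ℂ) • log t⁻¹ • indicator (Ioc (0 : ℝ) 1) (fun _ => (1 : ℂ)) t⁻¹ = (log⁺ t : ℂ) := by
  rcases le_or_gt 1 t with h | h
  · have hmem : t⁻¹ ∈ Ioc (0 : ℝ) 1 := ⟨inv_pos.2 ht, inv_le_one_of_one_le₀ h⟩
    rw [indicator_of_mem hmem, log_inv, posLog_eq_log (h.trans (le_abs_self t))]
    simp
  · have hnot : t⁻¹ ∉ Ioc (0 : ℝ) 1 := fun hmem => ((one_lt_inv₀ ht).2 h).not_ge hmem.2
    have habs : |t| ≤ 1 := (abs_of_pos ht).trans_le h.le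
    rw [indicator_of_notMem hnot, smul_zero, smul_zero, (posLog_eq_zero_iff t).2 habs,
      Complex.ofReal_zero]

theorem hasMellin_posLog {s : ℂ} (hs : s.re < 0) :
    HasMellin (fun t => (log⁺ t : ℂ)) s (1 / s ^ 2) := by
  have hlog := hasMellin_comp_inv (hasMellin_log_smul_indicator_Ioc (s := -s) (by simpa using hs))
  have hneg := hasMellin_const_smul hlog.1 (-1 : ℂ)
  rw [hlog.2, neg_sq, smul_eq_mul, neg_one_mul, neg_div, neg_neg] at hneg
  exact hasMellin_congr hneg fun t ht => neg_log_inv_smul_indicator_Ioc ht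

theorem hasMellin_cpow_mul_posLog {a s : ℂ} (h : (s + a).re < 0) :
    HasMellin (fun t => (t : ℂ) ^ a * (log⁺ t : ℂ)) s (1 / (s + a) ^ 2) :=
  ⟨MellinConvergent.cpow_smul.2 (hasMellin_posLog h).1,
    (mellin_cpow_smul _ _ _).trans (hasMellin_posLog h).2⟩

/-! ### Evaluation of the Meijer G-function -/

section MeijerG

variable {a : ℂ} {x : ℝ}

theorem meijerGLine_eq_mellinInv (m n : ℕ) {p q : ℕ} (a : Fin p → ℂ) (b : Fin q → ℂ) (x c : ℝ) :
    meijerGLine m n a b x c = mellinInv (-c) (fun w => meijerGIntegrand m n a b 1 (-w)) x := by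
  rw [meijerGLine, mellinInv, ← integral_neg_eq_self, Complex.real_smul]
  congr 1
  · push_cast
    rfl
  · refine integral_congr_ae (.of_forall fun y => ?_)
    have hline : -(((-c : ℝ) : ℂ) + y * I) = (c : ℂ) + ((-y : ℝ) : ℂ) * I := by
      push_cast
      ring
    simp only [meijerGIntegrand, Complex.one_cpow, mul_one, smul_eq_mul]
    rw [hline, mul_comm]

theorem meijerGIntegrand_neg_eq {w : ℂ} (hw : 1 + a.re < w.re) :
    meijerGIntegrand 3 0 ![-a, -a] ![0, -1 - a, -1 - a] 1 (-w) =
      Complex.Gamma w * (1 / (w - (1 + a)) ^ 2) := by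
  have hre : 0 < (w - (1 + a)).re := by simpa using hw
  have hprod : meijerGIntegrand 3 0 ![-a, -a] ![0, -1 - a, -1 - a] 1 (-w) =
      Complex.Gamma w * (Complex.Gamma (-1 - a + w) ^ 2 / Complex.Gamma (-a + w) ^ 2) := by
    simp [meijerGIntegrand, Finset.prod_filter, Fin.prod_univ_succ, sq, mul_div_assoc]
  have hrec : Complex.Gamma (-a + w) = (w - (1 + a)) * Complex.Gamma (w - (1 + a)) := by
    rw [← Complex.Gamma_add_one _ fun h => by simp [h] at hre]
    ring_nf
  rw [hprod, ← div_pow, hrec, show -1 - a + w = w - (1 + a) by ring,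
    div_mul_cancel_right₀ (Complex.Gamma_ne_zero_of_re_pos hre), inv_pow, one_div]

theorem hasMellin_laplaceTransform_cpow_mul_posLog {w : ℂ} (hw : 0 < w.re)
    (hwa : 1 + a.re < w.re) :
    HasMellin (laplaceTransform fun t => (t : ℂ) ^ a * (log⁺ t : ℂ)) w
      (Complex.Gamma w * (1 / (w - (1 + a)) ^ 2)) := by
  obtain ⟨hconv, hval⟩ := hasMellin_cpow_mul_posLog (a := a) (s := 1 - w) (by
    rw [Complex.add_re, Complex.sub_re, Complex.one_re]
    linarith)
  have h := hasMellin_laplaceTransform hw hconv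
  rwa [hval, show (1 - w + a) ^ 2 = (w - (1 + a)) ^ 2 by ring] at h

theorem meijerGLine_eq_laplaceTransform (hx : 0 < x) {c : ℝ} (h0 : c < 0) (hc : c < -1 - a.re) :
    meijerGLine 3 0 ![-a, -a] ![0, -1 - a, -1 - a] x c =
      laplaceTransform (fun t => (t : ℂ) ^ a * (log⁺ t : ℂ)) x := by
  set g : ℝ → ℂ := fun t => (t : ℂ) ^ a * (log⁺ t : ℂ)
  have hσ : 0 < -c := neg_pos.2 h0
  have hσa : 1 + a.re < -c := by linarith
  have hconv : MellinConvergent g (1 - (-c : ℝ)) := (hasMellin_cpow_mul_posLog (by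
    rw [Complex.add_re, Complex.sub_re, Complex.one_re, Complex.ofReal_re]
    linarith)).1
  have hL : ∀ w : ℂ, w.re = -c →
      HasMellin (laplaceTransform g) w (Complex.Gamma w * (1 / (w - (1 + a)) ^ 2)) :=
    fun w hw => hasMellin_laplaceTransform_cpow_mul_posLog (hw ▸ hσ) (hw ▸ hσa)
  have hre : ∀ y : ℝ, (((-c : ℝ) : ℂ) + y * I).re = -c := fun y => by simp
  have hint : Complex.VerticalIntegrable (mellin (laplaceTransform g)) (-c) :=
    (verticalIntegrable_Gamma_mul hσ (verticalIntegrable_one_div_sub_sq (a := 1 + a) (by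
      simpa using hσa.ne'))).congr (.of_forall fun y => (hL _ (hre y)).2.symm)
  rw [meijerGLine_eq_mellinInv, ← mellinInv_mellin_eq (-c) _ hx (hL _ (Complex.ofReal_re _)).1 hint
    (continuousAt_laplaceTransform hσ hconv hx)]
  refine mellinInv_congr fun w hw => ?_
  rw [(hL w hw).2, meijerGIntegrand_neg_eq (hw ▸ hσa)]

theorem meijerG_eq_laplaceTransform (a : ℂ) (hx : 0 < x) :
    meijerG 3 0 ![-a, -a] ![0, -1 - a, -1 - a] x =
      laplaceTransform (fun t => (t : ℂ) ^ a * (log⁺ t : ℂ)) x := by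
  have hsep : ∀ c : ℝ, IsSeparating 3 0 ![-a, -a] ![0, -1 - a, -1 - a] c ↔
      c < 0 ∧ c < -1 - a.re := fun c => by
    simp [IsSeparating, Fin.forall_fin_succ]
  have hex : ∃ c : ℝ, IsSeparating 3 0 ![-a, -a] ![0, -1 - a, -1 - a] c :=
    (exists_lt (min 0 (-1 - a.re))).imp fun c hc => (hsep c).2 (lt_min_iff.1 hc)
  obtain ⟨h0, hc⟩ := (hsep _).1 hex.choose_spec
  rw [meijerG, dif_pos hex, meijerGLine_eq_laplaceTransform hx h0 hc]

end MeijerG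

/-! ### The capacity term -/

theorem measurable_capacity : Measurable capacity := by
  unfold capacity logb
  fun_prop

theorem integrable_capacity_gammaMeasure {a r γ : ℝ} (ha : 0 < a) (hr : 0 < r) (hγ : 0 < γ) :
    Integrable (fun x => capacity (γ * x)) (gammaMeasure a r) := by
  have hmeas : Measurable fun x => capacity (γ * x) :=
    measurable_capacity.comp (measurable_const_mul γ)
  refine ((integrable_pow_gammaMeasure ha hr 1).const_mul (γ / log 2)).mono'
    hmeas.aestronglyMeasurable ?_
  filter_upwards [ae_gammaMeasure_pos a r] with x hx
  have hpos : 0 < γ * x := mul_pos hγ hx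
  have hlog : log (1 + γ * x) ≤ γ * x :=
    (log_le_sub_one_of_pos (by positivity)).trans_eq (add_sub_cancel_left 1 _)
  have hnonneg : 0 ≤ log (1 + γ * x) := log_nonneg (by linarith)
  rw [capacity, logb, norm_of_nonneg (by positivity), pow_one, div_mul_eq_mul_div]
  gcongr

theorem integral_comp_one_add_mul_gammaMeasure {E : Type*} [NormedAddCommGroup E] [NormedSpace ℝ E]
    {a γ : ℝ} (ha : 0 < a) (hγ : 0 < γ) (f : ℝ → E) :
    ∫ x, f (1 + γ * x) ∂gammaMeasure a 1 = (exp (1 / γ) / (Gamma a * γ ^ a)) •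
      ∫ t in Ioi 1, ((t - 1) ^ (a - 1) * exp (-(1 / γ * t))) • f t := by
  set g : ℝ → E := fun t => ((t - 1) ^ (a - 1) * exp (-(1 / γ * t))) • f t with hg
  have hshift : ∫ t in Ioi 1, g t = ∫ y in Ioi 0, g (1 + y) := by
    simpa using ((measurePreserving_add_left volume (1 : ℝ)).setIntegral_preimage_emb
      (measurableEmbedding_addLeft 1) g (Ioi 1)).symm
  have hscale : γ • ∫ x in Ioi 0, g (1 + γ * x) = ∫ y in Ioi 0, g (1 + y) := by
    simpa only [mul_zero] using integral_comp_mul_left_Ioi' (fun y => g (1 + y)) 0 hγ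
  rw [integral_gammaMeasure ha one_pos, hshift, ← hscale, ← integral_smul, ← integral_smul]
  refine setIntegral_congr_fun measurableSet_Ioi fun x hx => ?_
  have hx0 : 0 < x := hx
  have hpow : (γ * x) ^ (a - 1) = γ ^ a / γ * x ^ (a - 1) := by
    rw [mul_rpow hγ.le hx0.le, rpow_sub_one hγ.ne']
  have hexp : exp (-(1 / γ * (1 + γ * x))) = (exp (1 / γ))⁻¹ * exp (-x) := by
    rw [← exp_neg, ← exp_add]
    congr 1
    field_simp
    ring
  simp only [hg, add_sub_cancel_left, hpow, hexp, smul_smul,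
    gammaPDFReal_of_pos hx0, one_rpow, one_mul]
  congr 1
  field_simp

theorem sum_choose_mul_laplaceTransform (n : ℕ) {g : ℝ → ℂ} {x : ℝ}
    (hg : ∀ i : ℕ, IntegrableOn (fun t : ℝ => exp (-(x * t)) • ((t : ℂ) ^ i * g t)) (Ioi 0)) :
    ∑ i ∈ Finset.range (n + 1), (n.choose i : ℂ) * (-1) ^ (n - i) *
      laplaceTransform (fun t => (t : ℂ) ^ i * g t) x =
      laplaceTransform (fun t => (t - 1 : ℂ) ^ n * g t) x := by
  simp only [laplaceTransform, ← integral_const_mul]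
  rw [← integral_finsetSum _ fun i _ => (hg i).const_mul _]
  refine integral_congr_ae (.of_forall fun t => ?_)
  simp only [sub_eq_add_neg, add_pow, Finset.sum_mul, Finset.smul_sum, Complex.real_smul]
  exact Finset.sum_congr rfl fun i _ => by ring

theorem laplaceTransform_sub_one_pow_mul_posLog (n : ℕ) (x : ℝ) :
    laplaceTransform (fun t => (t - 1 : ℂ) ^ n * (log⁺ t : ℂ)) x =
      ((∫ t in Ioi 1, (t - 1) ^ n * exp (-(x * t)) * log t : ℝ) : ℂ) := by
  have hsupp : ∀ t ∈ Ioi (0 : ℝ) \ Ioi 1,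
      exp (-(x * t)) • ((t - 1 : ℂ) ^ n * (log⁺ t : ℂ)) = 0 := fun t ht => by
    have habs : |t| ≤ 1 := (abs_of_pos ht.1).trans_le (not_lt.1 ht.2)
    rw [(posLog_eq_zero_iff t).2 habs, Complex.ofReal_zero, mul_zero, smul_zero]
  rw [laplaceTransform, setIntegral_eq_of_subset_of_forall_sdiff_eq_zero measurableSet_Ioi
    (Ioi_subset_Ioi zero_le_one) hsupp, ← integral_complex_ofReal]
  refine setIntegral_congr_fun measurableSet_Ioi fun t ht => ?_
  have habs : 1 ≤ |t| := (mem_Ioi.1 ht).le.trans (le_abs_self t)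
  rw [posLog_eq_log habs, Complex.real_smul]
  push_cast
  ring

theorem integrableOn_exp_neg_mul_smul_pow_mul_posLog (i : ℕ) {x : ℝ} (hx : 0 < x) :
    IntegrableOn (fun t : ℝ => exp (-(x * t)) • ((t : ℂ) ^ i * (log⁺ t : ℂ))) (Ioi 0) := by
  have hconv : MellinConvergent (fun t => (t : ℂ) ^ (i : ℂ) * (log⁺ t : ℂ)) (1 - (i + 2)) :=
    (hasMellin_cpow_mul_posLog (by
      rw [show (1 - (i + 2) + i : ℂ) = -1 by ring, Complex.neg_re, Complex.one_re]
      exact neg_one_lt_zero)).1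
  simpa only [Complex.cpow_natCast] using integrableOn_exp_neg_mul_smul (w := i + 2)
    (by
      rw [Complex.add_re, Complex.natCast_re, Complex.re_ofNat]
      positivity) hconv hx

theorem sum_choose_mul_meijerG (n : ℕ) {x : ℝ} (hx : 0 < x) :
    ∑ i ∈ Finset.range (n + 1), (n.choose i : ℂ) * (-1) ^ (n - i) *
      meijerG 3 0 ![-(i : ℂ), -(i : ℂ)] ![0, -1 - (i : ℂ), -1 - (i : ℂ)] (x : ℂ) =
      ((∫ t in Ioi 1, (t - 1) ^ n * exp (-(x * t)) * log t : ℝ) : ℂ) := by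
  simp only [meijerG_eq_laplaceTransform _ hx, Complex.cpow_natCast]
  rw [sum_choose_mul_laplaceTransform n fun i => integrableOn_exp_neg_mul_smul_pow_mul_posLog i hx,
    laplaceTransform_sub_one_pow_mul_posLog]

theorem integral_capacity_gammaMeasure {N : ℕ} (hN : N ≠ 0) {γ : ℝ} (hγ : 0 < γ) :
    ((∫ x, capacity (γ * x) ∂gammaMeasure N 1 : ℝ) : ℂ) = Phi γ N := by
  obtain ⟨n, rfl⟩ := Nat.exists_eq_succ_of_ne_zero hN
  have hint : ∫ x, capacity (γ * x) ∂gammaMeasure n.succ 1 =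
      exp (1 / γ) / (log 2 * Gamma n.succ * γ ^ n.succ) *
        ∫ t in Ioi 1, (t - 1) ^ n * exp (-(1 / γ * t)) * log t := by
    have hn : (n.succ : ℝ) - 1 = n := by rw [Nat.cast_succ, add_sub_cancel_right]
    simp only [capacity]
    rw [integral_comp_one_add_mul_gammaMeasure (by positivity) hγ (logb 2)]
    simp only [hn, rpow_natCast, logb, smul_eq_mul, ← mul_div_assoc, integral_div]
    ring
  rw [Phi, Nat.succ_sub_one, sum_choose_mul_meijerG n (by positivity), hint, Complex.ofReal_mul]

/-! ### Second moments of independent sums and products -/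

section SecondMoment

variable {Ω Ω' : Type*} [MeasurableSpace Ω] [MeasurableSpace Ω'] {μ : Measure Ω}

theorem memLp_comp_of_hasLaw {E : Type*} [NormedAddCommGroup E] {ν : Measure Ω'} {X : Ω → Ω'}
    {f : Ω' → E} {p : ENNReal} (hX : HasLaw X ν μ) (hf : MemLp f p ν) :
    MemLp (fun ω => f (X ω)) p μ := by
  rw [← hX.map_eq] at hf
  exact hf.comp_of_map hX.aemeasurable

section InnerProductSpace

variable [IsProbabilityMeasure μ] {E : Type*} [NormedAddCommGroup E] [InnerProductSpace ℝ E]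
  [CompleteSpace E] [MeasurableSpace E] [BorelSpace E]

theorem integral_norm_sq_add_of_indepFun {X Y : Ω → E} (hX : MemLp X 2 μ) (hY : MemLp Y 2 μ)
    (hXY : IndepFun X Y μ) (hX0 : ∫ ω, X ω ∂μ = 0) :
    ∫ ω, ‖X ω + Y ω‖ ^ 2 ∂μ = ∫ ω, ‖X ω‖ ^ 2 ∂μ + ∫ ω, ‖Y ω‖ ^ 2 ∂μ := by
  have hX1 := hX.integrable one_le_two
  have hY1 := hY.integrable one_le_two
  have hcross : ∫ ω, inner ℝ (X ω) (Y ω) ∂μ = 0 :=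
    (hXY.integral_bilin hX1 hY1 (innerSL ℝ)).trans (by simp [hX0])
  have hinner : Integrable (fun ω => 2 * inner ℝ (X ω) (Y ω)) μ := by
    refine Integrable.const_mul ?_ 2
    refine (hX.norm.integrable_mul hY.norm).mono
      (hX.aestronglyMeasurable.inner hY.aestronglyMeasurable) (.of_forall fun ω => ?_)
    simpa using abs_real_inner_le_norm (X ω) (Y ω)
  have hXsq : Integrable (fun ω => ‖X ω‖ ^ 2) μ := hX.integrable_norm_pow two_ne_zero
  have hYsq : Integrable (fun ω => ‖Y ω‖ ^ 2) μ := hY.integrable_norm_pow two_ne_zero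
  simp only [norm_add_sq_real]
  rw [integral_add (by exact hXsq.add hinner) hYsq, integral_add hXsq hinner, integral_const_mul,
    hcross, mul_zero, add_zero]

theorem integral_norm_sq_sum_of_iIndepFun [SecondCountableTopology E] {ι : Type*} {X : ι → Ω → E}
    (hX : ∀ i, MemLp (X i) 2 μ) (hind : iIndepFun X μ) (hX0 : ∀ i, ∫ ω, X i ω ∂μ = 0)
    (s : Finset ι) : ∫ ω, ‖∑ i ∈ s, X i ω‖ ^ 2 ∂μ = ∑ i ∈ s, ∫ ω, ‖X i ω‖ ^ 2 ∂μ := by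
  induction s using Finset.cons_induction with
  | empty => simp
  | cons i s hi ih =>
    have hindep := hind.indepFun_finsetSum_of_notMem₀
      (fun j => (hX j).aestronglyMeasurable.aemeasurable) hi
    have hadd := integral_norm_sq_add_of_indepFun (hX i)
      (memLp_finsetSum' s fun j _ => hX j) hindep.symm (hX0 i)
    simp only [Finset.sum_apply] at hadd
    simp only [Finset.sum_cons]
    rw [hadd, ih]

end InnerProductSpace

section Mul

variable {𝕜 : Type*} [RCLike 𝕜] {X Y : Ω → 𝕜}

theorem indepFun_norm_sq (hXY : IndepFun X Y μ) :
    IndepFun (fun ω => ‖X ω‖ ^ 2) (fun ω => ‖Y ω‖ ^ 2) μ :=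
  hXY.comp (φ := fun z => ‖z‖ ^ 2) (ψ := fun z => ‖z‖ ^ 2) (by fun_prop) (by fun_prop)

theorem memLp_two_mul_of_indepFun (hX : MemLp X 2 μ) (hY : MemLp Y 2 μ) (hXY : IndepFun X Y μ) :
    MemLp (fun ω => X ω * Y ω) 2 μ := by
  have hmeas : AEStronglyMeasurable (fun ω => X ω * Y ω) μ :=
    hX.aestronglyMeasurable.mul hY.aestronglyMeasurable
  refine (memLp_two_iff_integrable_sq_norm hmeas).2 ?_
  simp only [norm_mul, mul_pow]
  exact (indepFun_norm_sq hXY).integrable_mul (hX.integrable_norm_pow two_ne_zero)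
    (hY.integrable_norm_pow two_ne_zero)

theorem integral_norm_sq_mul_of_indepFun (hX : AEStronglyMeasurable X μ)
    (hY : AEStronglyMeasurable Y μ) (hXY : IndepFun X Y μ) :
    ∫ ω, ‖X ω * Y ω‖ ^ 2 ∂μ = (∫ ω, ‖X ω‖ ^ 2 ∂μ) * ∫ ω, ‖Y ω‖ ^ 2 ∂μ := by
  simp only [norm_mul, mul_pow]
  exact (indepFun_norm_sq hXY).integral_fun_mul_eq_mul_integral (hX.norm.pow 2) (hY.norm.pow 2)

end Mul

end SecondMoment

/-! ### Second moments of complex Gaussian vectors -/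

section ComplexGaussianMoments

variable (v : ℝ≥0)

theorem memLp_id_complexGaussian : MemLp id 2 (complexGaussian v) := by
  have h := memLp_id_gaussianReal' (μ := 0) (v := v / 2) 2 (by simp)
  have hre : MemLp (fun p : ℝ × ℝ => (p.1 : ℂ)) 2
      ((gaussianReal 0 (v / 2)).prod (gaussianReal 0 (v / 2))) :=
    (h.comp_measurePreserving measurePreserving_fst).ofReal
  have him : MemLp (fun p : ℝ × ℝ => (p.2 : ℂ) * I) 2
      ((gaussianReal 0 (v / 2)).prod (gaussianReal 0 (v / 2))) :=
    (h.comp_measurePreserving measurePreserving_snd).ofReal.mul_const I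
  rw [complexGaussian, memLp_map_measure_iff (by fun_prop) (by fun_prop)]
  exact hre.add him

theorem integral_complexGaussian {E : Type*} [NormedAddCommGroup E] [NormedSpace ℝ E] {f : ℂ → E}
    (hf : AEStronglyMeasurable f (complexGaussian v)) :
    ∫ z, f z ∂complexGaussian v =
      ∫ p, f (p.1 + p.2 * I) ∂(gaussianReal 0 (v / 2)).prod (gaussianReal 0 (v / 2)) :=
  ((hasLaw_re_add_im_complexGaussian v).integral_comp hf).symm

theorem integral_id_complexGaussian : ∫ z, z ∂complexGaussian v = 0 := by
  have h : Integrable (fun x : ℝ => (x : ℂ)) (gaussianReal 0 (v / 2)) :=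
    ((memLp_id_gaussianReal' (μ := 0) (v := v / 2) 1 (by simp)).integrable le_rfl).ofReal
  have h0 : ∫ x : ℝ, (x : ℂ) ∂gaussianReal 0 (v / 2) = 0 := by
    rw [integral_complex_ofReal, integral_id_gaussianReal, Complex.ofReal_zero]
  rw [integral_complexGaussian v (by fun_prop),
    integral_add (h.comp_fst _) ((h.comp_snd _).mul_const _), integral_mul_const,
    integral_fun_fst (fun x : ℝ => (x : ℂ)), integral_fun_snd (fun x : ℝ => (x : ℂ)), h0]
  simp

theorem integral_norm_sq_complexGaussian : ∫ z, ‖z‖ ^ 2 ∂complexGaussian v = v := by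
  have h : Integrable (fun x : ℝ => x ^ 2) (gaussianReal 0 (v / 2)) :=
    (memLp_id_gaussianReal' (μ := 0) (v := v / 2) 2 (by simp)).integrable_sq
  have hvar : ∫ x, x ^ 2 ∂gaussianReal 0 (v / 2) = v / 2 := by
    simpa [variance_of_integral_eq_zero aemeasurable_id] using
      variance_id_gaussianReal (μ := 0) (v := v / 2)
  rw [integral_complexGaussian v (by fun_prop)]
  simp only [Complex.sq_norm, Complex.normSq_add_mul_I]
  rw [integral_add (h.comp_fst _) (h.comp_snd _), integral_fun_fst (fun x : ℝ => x ^ 2),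
    integral_fun_snd (fun x : ℝ => x ^ 2), hvar]
  simp

variable {N : ℕ} (w : EuclideanSpace ℂ (Fin N))

theorem memLp_apply_mul (j : Fin N) :
    MemLp (fun x : EuclideanSpace ℂ (Fin N) => x j * w j) 2 (complexGaussianVec N) :=
  (memLp_comp_of_hasLaw (hasLaw_apply_complexGaussianVec j) (memLp_id_complexGaussian 1)).mul_const
    (w j)

theorem integral_apply_mul (j : Fin N) : ∫ x, x j * w j ∂complexGaussianVec N = 0 := by
  rw [integral_mul_const, (hasLaw_apply_complexGaussianVec j).integral_eq,
    integral_id_complexGaussian, zero_mul]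

theorem integral_norm_sq_apply_mul (j : Fin N) :
    ∫ x, ‖x j * w j‖ ^ 2 ∂complexGaussianVec N = ‖w j‖ ^ 2 := by
  have hcoord := (hasLaw_apply_complexGaussianVec j).integral_comp (f := fun z => ‖z‖ ^ 2)
    (by fun_prop)
  rw [integral_norm_sq_complexGaussian] at hcoord
  simp only [norm_mul, mul_pow, integral_mul_const]
  rw [show ∫ x : EuclideanSpace ℂ (Fin N), ‖x j‖ ^ 2 ∂complexGaussianVec N = _ from hcoord,
    NNReal.coe_one, one_mul]

theorem memLp_rowMul : MemLp (fun x => rowMul x w) 2 (complexGaussianVec N) :=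
  memLp_finsetSum _ fun j _ => memLp_apply_mul w j

theorem integral_rowMul : ∫ x, rowMul x w ∂complexGaussianVec N = 0 := by
  simp only [rowMul]
  rw [integral_finsetSum _ fun j _ => (memLp_apply_mul w j).integrable one_le_two]
  exact Finset.sum_eq_zero fun j _ => integral_apply_mul w j

theorem integral_norm_sq_rowMul : ∫ x, ‖rowMul x w‖ ^ 2 ∂complexGaussianVec N = ‖w‖ ^ 2 := by
  have hind : iIndepFun (fun (j : Fin N) (x : EuclideanSpace ℂ (Fin N)) => x j * w j)
      (complexGaussianVec N) :=
    iIndepFun_apply_complexGaussianVec.comp (fun j z => z * w j) (by fun_prop)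
  simp only [rowMul]
  rw [integral_norm_sq_sum_of_iIndepFun (memLp_apply_mul w) hind (integral_apply_mul w),
    EuclideanSpace.norm_sq_eq]
  exact Finset.sum_congr rfl fun j _ => integral_norm_sq_apply_mul w j

section RandomWeights

variable {w} {α : Type*} [MeasurableSpace α] {ν : Measure α} {b : α → EuclideanSpace ℂ (Fin N)}

theorem aestronglyMeasurable_rowMul_prod (hb : AEStronglyMeasurable b ν) :
    AEStronglyMeasurable (fun p : α × EuclideanSpace ℂ (Fin N) => rowMul p.2 (b p.1))
      (ν.prod (complexGaussianVec N)) := by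
  have hmeas : Measurable fun p : EuclideanSpace ℂ (Fin N) × EuclideanSpace ℂ (Fin N) =>
      rowMul p.2 p.1 := by
    unfold rowMul
    fun_prop
  have hpair : AEMeasurable (fun p : α × EuclideanSpace ℂ (Fin N) => (b p.1, p.2))
      (ν.prod (complexGaussianVec N)) :=
    hb.aemeasurable.comp_fst.prodMk measurable_snd.aemeasurable
  exact (hmeas.comp_aemeasurable hpair).aestronglyMeasurable

theorem memLp_rowMul_prod (hb : MemLp b 2 ν) :
    MemLp (fun p : α × EuclideanSpace ℂ (Fin N) => rowMul p.2 (b p.1)) 2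
      (ν.prod (complexGaussianVec N)) := by
  have hmeas := aestronglyMeasurable_rowMul_prod hb.aestronglyMeasurable
  refine (memLp_two_iff_integrable_sq_norm hmeas).2 <|
    (integrable_prod_iff (hmeas.norm.pow 2)).2
      ⟨.of_forall fun a => (memLp_rowMul (b a)).integrable_norm_pow two_ne_zero, ?_⟩
  simpa only [Pi.pow_apply, norm_pow, norm_norm, integral_norm_sq_rowMul] using
    hb.integrable_norm_pow two_ne_zero

theorem integral_rowMul_prod [IsFiniteMeasure ν] (hb : MemLp b 2 ν) :
    ∫ p : α × EuclideanSpace ℂ (Fin N), rowMul p.2 (b p.1) ∂ν.prod (complexGaussianVec N) = 0 := by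
  rw [integral_prod _ ((memLp_rowMul_prod hb).integrable one_le_two)]
  simp only [integral_rowMul, integral_zero]

theorem integral_norm_sq_rowMul_prod [SFinite ν] (hb : MemLp b 2 ν) :
    ∫ p : α × EuclideanSpace ℂ (Fin N), ‖rowMul p.2 (b p.1)‖ ^ 2 ∂ν.prod (complexGaussianVec N) =
      ∫ a, ‖b a‖ ^ 2 ∂ν := by
  rw [integral_prod _ ((memLp_rowMul_prod hb).integrable_norm_pow two_ne_zero)]
  simp only [integral_norm_sq_rowMul]

end RandomWeights

end ComplexGaussianMoments

/-! ### The beamforming vector -/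

section Beamformer

variable {N : ℕ}

theorem norm_beamformer {h : EuclideanSpace ℂ (Fin N)} (hh : h ≠ 0) : ‖beamformer h‖ = 1 := by
  have hconj :
      ‖(WithLp.toLp 2 fun j => (starRingEnd ℂ) (h j) : EuclideanSpace ℂ (Fin N))‖ = ‖h‖ := by
    simp [EuclideanSpace.norm_eq]
  rw [beamformer, norm_smul, hconj, Complex.norm_real, norm_inv, norm_norm,
    inv_mul_cancel₀ (norm_ne_zero_iff.2 hh)]

theorem norm_beamformer_le_one (h : EuclideanSpace ℂ (Fin N)) : ‖beamformer h‖ ≤ 1 := by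
  rcases eq_or_ne h 0 with rfl | hh
  · simp [beamformer]
  · exact (norm_beamformer hh).le

theorem measurable_beamformer :
    Measurable (beamformer : EuclideanSpace ℂ (Fin N) → EuclideanSpace ℂ (Fin N)) := by
  unfold beamformer
  fun_prop

theorem measurable_rowMul_beamformer :
    Measurable fun p : EuclideanSpace ℂ (Fin N) × EuclideanSpace ℂ (Fin N) =>
      rowMul p.2 (beamformer p.1) := by
  unfold rowMul
  fun_prop

theorem memLp_beamformer (p : ENNReal) (μ : Measure (EuclideanSpace ℂ (Fin N)))
    [IsFiniteMeasure μ] : MemLp beamformer p μ :=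
  .of_bound measurable_beamformer.aestronglyMeasurable 1 (.of_forall norm_beamformer_le_one)

theorem ae_complexGaussianVec_ne_zero (hN : N ≠ 0) : ∀ᵐ h ∂complexGaussianVec N, h ≠ 0 := by
  have hpos := ((hasLaw_normSq_complexGaussianVec hN).ae_iff (p := fun x => 0 < x)
    (measurableSet_setOfPred.1 measurableSet_Ioi)).2 (ae_gammaMeasure_pos N 1)
  filter_upwards [hpos] with h hh
  exact fun h0 => by simp [h0] at hh

theorem integral_norm_sq_beamformer (hN : N ≠ 0) :
    ∫ h, ‖beamformer h‖ ^ 2 ∂complexGaussianVec N = 1 := by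
  have hone : (fun h => ‖beamformer h‖ ^ 2) =ᵐ[complexGaussianVec N] fun _ => 1 := by
    filter_upwards [ae_complexGaussianVec_ne_zero hN] with h hh
    rw [norm_beamformer hh, one_pow]
  rw [integral_congr_ae hone, integral_const, probReal_univ, one_smul]

end Beamformer

/-! ### The variance of the interference plus noise -/

section ComplexVar

variable {Ω : Type*} [MeasurableSpace Ω] {μ : Measure Ω} {X Y : Ω → ℂ}

theorem complexVar_of_integral_eq_zero (hX : ∫ ω, X ω ∂μ = 0) :
    complexVar μ X = ∫ ω, ‖X ω‖ ^ 2 ∂μ := by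
  simp only [complexVar, hX, sub_zero]

theorem complexVar_const_mul (c : ℂ) (X : Ω → ℂ) :
    complexVar μ (fun ω => c * X ω) = ‖c‖ ^ 2 * complexVar μ X := by
  simp only [complexVar, integral_const_mul, ← mul_sub, norm_mul, mul_pow]

theorem complexVar_add_of_indepFun [IsProbabilityMeasure μ] (hX : MemLp X 2 μ) (hY : MemLp Y 2 μ)
    (hXY : IndepFun X Y μ) :
    complexVar μ (fun ω => X ω + Y ω) = complexVar μ X + complexVar μ Y := by
  set mX := ∫ ω, X ω ∂μ with hmX
  set mY := ∫ ω, Y ω ∂μ with hmY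
  have hX1 := hX.integrable one_le_two
  have hX0 : ∫ ω, (X ω - mX) ∂μ = 0 := by
    rw [integral_sub hX1 (integrable_const _), integral_const, probReal_univ, one_smul, sub_self]
  have hXY' : IndepFun (fun ω => X ω - mX) (fun ω => Y ω - mY) μ :=
    hXY.comp (φ := fun z => z - mX) (ψ := fun z => z - mY) (by fun_prop) (by fun_prop)
  simp only [complexVar, integral_add hX1 (hY.integrable one_le_two), ← hmX, ← hmY,
    add_sub_add_comm]
  exact integral_norm_sq_add_of_indepFun (hX.sub (memLp_const mX)) (hY.sub (memLp_const mY))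
    hXY' hX0

end ComplexVar

/-! ### The SINR and the rate -/

theorem effSNR_pos {ρ φ : ℝ} (hρ : 0 < ρ) (hφ : 0 < φ) (hφ1 : φ ≤ 1) : 0 < effSNR ρ φ := by
  have : 0 ≤ (1 - φ) * ρ := mul_nonneg (by linarith) hρ.le
  unfold effSNR
  positivity

namespace IsUplinkModel

variable {Ω : Type*} [MeasurableSpace Ω] {N : ℕ} {μ : Measure Ω}
  {σ2 : ℝ≥0} {hu e : Ω → EuclideanSpace ℂ (Fin N)} {u n : Ω → ℂ}

theorem hasLaw_norm_sq (h : IsUplinkModel μ σ2 hu e u n) (hN : N ≠ 0) :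
    HasLaw (fun ω => ‖hu ω‖ ^ 2) (gammaMeasure N 1) μ :=
  (hasLaw_normSq_complexGaussianVec hN).fun_comp h.hu_law

theorem hasLaw_prod (h : IsUplinkModel μ σ2 hu e u n) : HasLaw (fun ω => (hu ω, e ω))
    ((complexGaussianVec N).prod (complexGaussianVec N)) μ :=
  have := h.hu_law.isProbabilityMeasure
  h.indep_hu_e.hasLaw_prod h.hu_law h.e_law

theorem ae_norm_beamformer (h : IsUplinkModel μ σ2 hu e u n) (hN : N ≠ 0) :
    ∀ᵐ ω ∂μ, ‖beamformer (hu ω)‖ = 1 := by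
  have hne := (h.hu_law.ae_iff (p := fun v => v ≠ 0)
    (measurableSet_setOfPred.1 (measurableSet_singleton 0).compl)).2
      (ae_complexGaussianVec_ne_zero hN)
  filter_upwards [hne] with ω hω using norm_beamformer hω

theorem integral_norm_sq_signal (h : IsUplinkModel μ σ2 hu e u n) (hN : N ≠ 0) :
    ∫ ω, ‖u ω‖ ^ 2 ∂μ = 1 := by
  rw [← h.power]
  refine integral_congr_ae ?_
  filter_upwards [h.ae_norm_beamformer hN] with ω hω
  rw [norm_smul, hω, mul_one]

theorem memLp_signal (h : IsUplinkModel μ σ2 hu e u n) (hN : N ≠ 0) : MemLp u 2 μ := by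
  refine (memLp_two_iff_integrable_sq_norm h.u_meas.aestronglyMeasurable).2 ?_
  refine .of_integral_ne_zero ?_
  rw [h.integral_norm_sq_signal hN]
  exact one_ne_zero

theorem memLp_interference (h : IsUplinkModel μ σ2 hu e u n) :
    MemLp (fun ω => rowMul (e ω) (beamformer (hu ω))) 2 μ := by
  have hW := memLp_rowMul_prod (memLp_beamformer (N := N) 2 (complexGaussianVec N))
  exact (memLp_comp_of_hasLaw h.hasLaw_prod hW :)

theorem integral_interference (h : IsUplinkModel μ σ2 hu e u n) :
    ∫ ω, rowMul (e ω) (beamformer (hu ω)) ∂μ = 0 :=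
  (h.hasLaw_prod.integral_comp measurable_rowMul_beamformer.aestronglyMeasurable).trans
    (integral_rowMul_prod (memLp_beamformer 2 _))

theorem integral_norm_sq_interference (h : IsUplinkModel μ σ2 hu e u n) (hN : N ≠ 0) :
    ∫ ω, ‖rowMul (e ω) (beamformer (hu ω))‖ ^ 2 ∂μ = 1 :=
  (h.hasLaw_prod.integral_comp
    (measurable_rowMul_beamformer.norm.pow_const 2).aestronglyMeasurable).trans <|
      (integral_norm_sq_rowMul_prod (memLp_beamformer 2 _)).trans (integral_norm_sq_beamformer hN)

theorem indepFun_interference_signal (h : IsUplinkModel μ σ2 hu e u n) :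
    IndepFun (fun ω => rowMul (e ω) (beamformer (hu ω))) u μ :=
  h.indep_u.comp measurable_rowMul_beamformer measurable_id

theorem indepFun_interference_mul_signal_noise (h : IsUplinkModel μ σ2 hu e u n) :
    IndepFun (fun ω => rowMul (e ω) (beamformer (hu ω)) * u ω) n μ := by
  have hmeas : Measurable fun p : EuclideanSpace ℂ (Fin N) × EuclideanSpace ℂ (Fin N) × ℂ =>
      rowMul p.2.1 (beamformer p.1) * p.2.2 :=
    (measurable_rowMul_beamformer.comp (measurable_fst.prodMk measurable_snd.fst)).mul
      measurable_snd.snd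
  exact h.indep_n.comp hmeas measurable_id

theorem complexVar_interference_mul_signal (h : IsUplinkModel μ σ2 hu e u n) (hN : N ≠ 0) :
    complexVar μ (fun ω => rowMul (e ω) (beamformer (hu ω)) * u ω) = 1 := by
  have hW := h.memLp_interference.aestronglyMeasurable
  have hu := h.u_meas.aestronglyMeasurable
  rw [complexVar_of_integral_eq_zero, integral_norm_sq_mul_of_indepFun hW hu
    h.indepFun_interference_signal, h.integral_norm_sq_interference hN,
    h.integral_norm_sq_signal hN, mul_one]
  rw [h.indepFun_interference_signal.integral_fun_mul_eq_mul_integral hW hu,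
    h.integral_interference, zero_mul]

theorem complexVar_noise (h : IsUplinkModel μ σ2 hu e u n) : complexVar μ n = σ2 := by
  rw [complexVar_of_integral_eq_zero (h.n_law.integral_eq.trans (integral_id_complexGaussian σ2)),
    ← integral_norm_sq_complexGaussian σ2]
  exact h.n_law.integral_comp (f := fun z => ‖z‖ ^ 2) (by fun_prop)

theorem effNoiseVar_eq (h : IsUplinkModel μ σ2 hu e u n) (hN : N ≠ 0) {P φ : ℝ} (hP : 0 ≤ P)
    (hφ : φ ≤ 1) : effNoiseVar μ P φ hu e u n = P * (1 - φ) + σ2 := by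
  have := h.hu_law.isProbabilityMeasure
  set c : ℂ := ((√(P * (1 - φ)) : ℝ) : ℂ)
  have hc : ‖c‖ ^ 2 = P * (1 - φ) := by
    rw [Complex.norm_real, norm_of_nonneg (sqrt_nonneg _),
      sq_sqrt (mul_nonneg hP (sub_nonneg.2 hφ))]
  have hWu : MemLp (fun ω => rowMul (e ω) (beamformer (hu ω)) * u ω) 2 μ :=
    memLp_two_mul_of_indepFun h.memLp_interference (h.memLp_signal hN)
      h.indepFun_interference_signal
  have hn : MemLp n 2 μ :=
    memLp_comp_of_hasLaw (f := id) h.n_law (memLp_id_complexGaussian σ2)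
  have hind := h.indepFun_interference_mul_signal_noise.comp (measurable_const_mul c) measurable_id
  simp only [effNoiseVar, effNoise, mul_assoc]
  rw [complexVar_add_of_indepFun (hWu.const_mul c) hn hind, complexVar_const_mul, hc,
    h.complexVar_interference_mul_signal hN, h.complexVar_noise, mul_one]

theorem sinr_eq (h : IsUplinkModel μ σ2 hu e u n) (hN : N ≠ 0) {P φ : ℝ} (hP : 0 ≤ P) (hφ : φ ≤ 1)
    (hσ : 0 < σ2) (ω : Ω) : sinr μ P φ hu e u n ω = effSNR (P / σ2) φ * ‖hu ω‖ ^ 2 := by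
  have hσ' : (σ2 : ℝ) ≠ 0 := NNReal.coe_ne_zero.2 hσ.ne'
  have hvar : (1 - φ) * (P / σ2) + 1 = (P * (1 - φ) + σ2) / σ2 := by
    field_simp
  rw [sinr, h.effNoiseVar_eq hN hP hφ, effSNR, hvar, div_mul_eq_mul_div P,
    div_div_div_cancel_right₀ hσ', div_mul_eq_mul_div]

theorem integrable_capacity (h : IsUplinkModel μ σ2 hu e u n) (hN : N ≠ 0) {γ : ℝ} (hγ : 0 < γ) :
    Integrable (fun ω => capacity (γ * ‖hu ω‖ ^ 2)) μ := by
  have hlaw := h.hasLaw_norm_sq hN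
  have hint := integrable_capacity_gammaMeasure (a := N) (by positivity) one_pos hγ
  rw [← hlaw.map_eq] at hint
  exact hint.comp_aemeasurable hlaw.aemeasurable

theorem integral_capacity (h : IsUplinkModel μ σ2 hu e u n) (hN : N ≠ 0) (γ : ℝ) :
    ∫ ω, capacity (γ * ‖hu ω‖ ^ 2) ∂μ = ∫ x, capacity (γ * x) ∂gammaMeasure N 1 :=
  (h.hasLaw_norm_sq hN).integral_comp
    (measurable_capacity.comp (measurable_const_mul γ)).aestronglyMeasurable

theorem integrable_rateLoss (h : IsUplinkModel μ σ2 hu e u n) (T : ℕ) (ε γ : ℝ) :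
    Integrable (fun ω => rateLoss T ε (γ * ‖hu ω‖ ^ 2)) μ :=
  have := h.hu_law.isProbabilityMeasure
  UplinkTraining.integrable_rateLoss T ε ((h.hu_law.aemeasurable.norm.pow_const 2).const_mul γ)

theorem integral_rateLoss (h : IsUplinkModel μ σ2 hu e u n) (hN : N ≠ 0) (T : ℕ) (ε γ : ℝ) :
    ∫ ω, rateLoss T ε (γ * ‖hu ω‖ ^ 2) ∂μ = ∫ x, rateLoss T ε (γ * x) ∂gammaMeasure N 1 :=
  (h.hasLaw_norm_sq hN).integral_comp
    ((measurable_rateLoss T ε).comp (measurable_const_mul γ)).aestronglyMeasurable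

theorem rateUplink_eq (h : IsUplinkModel μ σ2 hu e u n) (hN : N ≠ 0) {P φ : ℝ} (hP : 0 < P)
    (hφ0 : 0 < φ) (hφ : φ ≤ 1) (hσ : 0 < σ2) (T : ℕ) (ε : ℝ) :
    rateUplink μ P φ hu e u n T ε = ∫ ω, capacity (effSNR (P / σ2) φ * ‖hu ω‖ ^ 2) ∂μ -
      ∫ ω, rateLoss T ε (effSNR (P / σ2) φ * ‖hu ω‖ ^ 2) ∂μ := by
  have hγ : 0 < effSNR (P / σ2) φ := effSNR_pos (div_pos hP (NNReal.coe_pos.2 hσ)) hφ0 hφ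
  simp only [rateUplink, h.sinr_eq hN hP.le hφ hσ]
  exact integral_sub (h.integrable_capacity hN hγ) (h.integrable_rateLoss T ε _)

end IsUplinkModel

end UplinkTraining

theorem theorem1 :
    ∃ K : ℝ, ∀ (N T : ℕ) (P φ ε : ℝ) (σ2 : ℝ≥0) (Ω : Type*) [MeasurableSpace Ω]
      (μ : Measure Ω) [IsProbabilityMeasure μ]
      (hu e : Ω → EuclideanSpace ℂ (Fin N)) (u n : Ω → ℂ),
      1 ≤ N → 1 ≤ T → 0 < P → 0 < φ → φ ≤ 1 → 0 < ε → ε < 1 → 0 < σ2 →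
      UplinkTraining.IsUplinkModel μ σ2 hu e u n →
      ∀ γ : ℝ, γ = UplinkTraining.effSNR (P / σ2) φ →
      ∀ D : ℝ, D = ∫ ω, UplinkTraining.rateLoss T ε (γ * ‖hu ω‖ ^ 2) ∂μ →
        -- the SINR in terms of the effective SNR
        (∀ ω, UplinkTraining.sinr μ P φ hu e u n ω = γ * ‖hu ω‖ ^ 2) ∧
        Integrable (fun ω => UplinkTraining.capacity (γ * ‖hu ω‖ ^ 2)) μ ∧
        Integrable (fun ω => UplinkTraining.rateLoss T ε (γ * ‖hu ω‖ ^ 2)) μ ∧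
        -- the capacity term is an expectation over a Gamma(N,1) variable, with exact value Φ
        Integrable (fun x => UplinkTraining.capacity (γ * x)) (gammaMeasure N 1) ∧
        ∫ ω, UplinkTraining.capacity (γ * ‖hu ω‖ ^ 2) ∂μ =
          ∫ x, UplinkTraining.capacity (γ * x) ∂(gammaMeasure N 1) ∧
        ((∫ x, UplinkTraining.capacity (γ * x) ∂(gammaMeasure N 1) : ℝ) : ℂ) =
          UplinkTraining.Phi γ N ∧
        -- the dispersion term is an expectation over a Gamma(N,1) variable
        D = ∫ x, UplinkTraining.rateLoss T ε (γ * x) ∂(gammaMeasure N 1) ∧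
        -- the exact decomposition of the rate
        ((UplinkTraining.rateUplink μ P φ hu e u n T ε : ℝ) : ℂ) =
          UplinkTraining.Phi γ N - (D : ℂ) ∧
        -- the Laplace approximation of the dispersion term, and so of the rate
        (2 ≤ N →
          |D - UplinkTraining.Psi γ N T ε| ≤ K / ((N : ℝ) - 1) * |UplinkTraining.Psi γ N T ε| ∧
          ‖((UplinkTraining.rateUplink μ P φ hu e u n T ε : ℝ) : ℂ) -
              (UplinkTraining.Phi γ N - (UplinkTraining.Psi γ N T ε : ℂ))‖ ≤
            K / ((N : ℝ) - 1) * |UplinkTraining.Psi γ N T ε|) := by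
  refine ⟨7, fun N T P φ ε σ2 Ω _ μ _ hu e u n hN _ hP hφ hφ1 _ _ hσ h γ hγ D hD => ?_⟩
  subst hγ
  have hN0 : N ≠ 0 := Nat.one_le_iff_ne_zero.1 hN
  have hγ := UplinkTraining.effSNR_pos (div_pos hP (NNReal.coe_pos.2 hσ)) hφ hφ1
  have hcap := h.integral_capacity hN0 (UplinkTraining.effSNR (P / σ2) φ)
  have hPhi := UplinkTraining.integral_capacity_gammaMeasure hN0 hγ
  have hloss := hD.trans (h.integral_rateLoss hN0 T ε _)
  have hrate : ((UplinkTraining.rateUplink μ P φ hu e u n T ε : ℝ) : ℂ) =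
      UplinkTraining.Phi (UplinkTraining.effSNR (P / σ2) φ) N - (D : ℂ) := by
    rw [h.rateUplink_eq hN0 hP hφ hφ1 hσ, ← hD, hcap, Complex.ofReal_sub, hPhi]
  refine ⟨h.sinr_eq hN0 hP.le hφ1 hσ, h.integrable_capacity hN0 hγ, h.integrable_rateLoss T ε _,
    UplinkTraining.integrable_capacity_gammaMeasure (by positivity) one_pos hγ, hcap, hPhi, hloss,
    hrate, fun hN2 => ?_⟩
  have hbound := UplinkTraining.abs_integral_rateLoss_sub_Psi_le T ε hγ hN2
  rw [← hloss] at hbound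
  refine ⟨hbound, ?_⟩
  rwa [hrate, sub_sub_sub_cancel_left, ← Complex.ofReal_sub, Complex.norm_real, Real.norm_eq_abs,
    abs_sub_comm]
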